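/- Let $G$ be a finite simple connected planar graph, 2-cell embedded in the sphere, and count the outer face among its faces. The size $|f|$ of a face $f$ is the length of its boundary walk (an edge with $f$ on both sides counts twice). For a vertex $v$, the face vector of $v$ is the multiset of the sizes of the $\deg(v)$ faces touching $v$, listed with multiplicity (one for each corner at $v$), and the combinatorial curvature of $v$ is $$K(v)=1-\frac{\deg(v)}{2}+\sum_{f}\frac{1}{|f|},$$ where the sum runs over the faces touching $v$, with multiplicity. A prism of order $N$ is such a graph with exactly $2N$ vertices, two faces of size $N$ and $N$ faces of size $4$ (as a multiset of face sizes), in which every vertex has face vector $\{4,4,N\}$. An antiprism of order $N$ is such a graph with exactly $2N$ vertices, two faces of size $N$ and $2N$ faces of size $3$, in which every vertex has face vector $\{3,3,3,N\}$. Call $G$ a planar PCC graph if $K(v)>0$ and $\deg(v)\ge 3$ for every vertex $v$, and $G$ is neither a prism nor an antiprism of any order. **Theorem 13.1.** If $G$ is a planar PCC graph, then every face $f$ of $G$ satisfies $|f|\le 41$. -/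

import Mathlib

/-- A rotation system on a simple graph `G`: for each vertex `v`, a cyclic order of the edges at `v`.
It is given by a permutation `rot` of the darts (oriented edges) of `G` which sends each dart to the
next dart, counterclockwise, with the same initial vertex; the darts issuing from one vertex form a
single cycle. By the Heffter-Edmonds principle, the rotation systems on a connected finite graph are
the 2-cell embeddings of the graph in closed oriented surfaces (up to orientation preserving
homeomorphism). -/
structure RotationSystem {V : Type*} (G : SimpleGraph V) where
  /-- the next dart around the initial vertex -/
  rot : Equiv.Perm G.Dart
  fst_rot : ∀ d : G.Dart, (rot d).fst = d.fst
  sameCycle_rot : ∀ d e : G.Dart, d.fst = e.fst → rot.SameCycle d e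

namespace RotationSystem

section Faces

variable {V : Type*} {G : SimpleGraph V} (R : RotationSystem G)

/-- One step along the boundary of a face: from the dart `u → v` to the dart which follows
`v → u` in the cyclic order at `v`. -/
def facePerm : Equiv.Perm G.Dart :=
  R.rot * SimpleGraph.Dart.symm_involutive.toPerm

/-- The faces of the embedding (the outer face included) are the orbits of `facePerm`,
that is, the closed walks bounding the faces. -/
def Face : Type _ := Quotient (Equiv.Perm.SameCycle.setoid R.facePerm)

/-- The face whose boundary walk passes through the dart `d`. The corner of this face at `d.fst`
is the one between `d` and the dart before it in the cyclic order at `d.fst`, so each corner at a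
vertex `v` corresponds to exactly one dart issuing from `v`. -/
def faceOf (d : G.Dart) : R.Face := Quotient.mk (Equiv.Perm.SameCycle.setoid R.facePerm) d

end Faces

section Finite

variable {V : Type*} [Fintype V] [DecidableEq V] {G : SimpleGraph V} [DecidableRel G.Adj]
  (R : RotationSystem G)

instance : DecidableRel (Equiv.Perm.SameCycle.setoid R.facePerm).r :=
  fun a b => inferInstanceAs (Decidable (R.facePerm.SameCycle a b))

instance : DecidableEq R.Face :=
  inferInstanceAs (DecidableEq (Quotient (Equiv.Perm.SameCycle.setoid R.facePerm)))

instance : Fintype R.Face :=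
  inferInstanceAs (Fintype (Quotient (Equiv.Perm.SameCycle.setoid R.facePerm)))

/-- The size `|f|` of a face: the length of its boundary walk, so that an edge with `f` on both
sides counts twice. -/
def faceSize (f : R.Face) : ℕ :=
  (Finset.univ.filter fun d : G.Dart => R.faceOf d = f).card

/-- The multiset of the faces touching the vertex `v`, one for each corner at `v`. -/
def facesAt (v : V) : Multiset R.Face :=
  (Finset.univ.filter fun d : G.Dart => d.fst = v).val.map R.faceOf

/-- The face vector of `v`: the multiset of the sizes of the faces touching `v`. -/
def faceVector (v : V) : Multiset ℕ := (R.facesAt v).map R.faceSize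

/-- The combinatorial curvature `K(v) = 1 - deg(v)/2 + ∑ 1/|f|`, the sum being over the faces `f`
touching `v`, with multiplicity. -/
def curvature (v : V) : ℚ :=
  1 - (G.degree v : ℚ) / 2 + ((R.facesAt v).map fun f => 1 / (R.faceSize f : ℚ)).sum

/-- The multiset of the sizes of all the faces. -/
def faceSizes : Multiset ℕ := (Finset.univ : Finset R.Face).val.map R.faceSize

/-- The embedding is an embedding in the sphere: `G` is connected and the closed oriented surface
carrying it has Euler characteristic `2`. (Meant for graphs with at least one edge: the single face
of a one-vertex graph has no dart on its boundary.) -/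
def IsSpherical : Prop :=
  G.Connected ∧
    (Fintype.card V : ℤ) - (G.edgeFinset.card : ℤ) + (Fintype.card R.Face : ℤ) = 2

/-- A prism of order `N`: `2N` vertices, two faces of size `N` and `N` faces of size `4`,
all face vectors being `{4, 4, N}`. -/
def IsPrism (N : ℕ) : Prop :=
  R.IsSpherical ∧ Fintype.card V = 2 * N ∧
    R.faceSizes = Multiset.replicate 2 N + Multiset.replicate N 4 ∧
    ∀ v : V, R.faceVector v = {4, 4, N}

/-- An antiprism of order `N`: `2N` vertices, two faces of size `N` and `2N` faces of size `3`,
all face vectors being `{3, 3, 3, N}`. -/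
def IsAntiprism (N : ℕ) : Prop :=
  R.IsSpherical ∧ Fintype.card V = 2 * N ∧
    R.faceSizes = Multiset.replicate 2 N + Multiset.replicate (2 * N) 3 ∧
    ∀ v : V, R.faceVector v = {3, 3, 3, N}

/-- A planar PCC graph: a finite simple connected graph embedded in the sphere, with positive
combinatorial curvature and degree at least `3` at every vertex, which is neither a prism nor an
antiprism. -/
structure IsPlanarPCC : Prop where
  spherical : R.IsSpherical
  curvature_pos : ∀ v : V, 0 < R.curvature v
  three_le_degree : ∀ v : V, 3 ≤ G.degree v
  not_prism : ∀ N : ℕ, ¬ R.IsPrism N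
  not_antiprism : ∀ N : ℕ, ¬ R.IsAntiprism N

end Finite

end RotationSystem

/-!
The proof is a discharging argument. Suppose that some face has at least `42` sides, and call such
faces large. By the combinatorial Gauss-Bonnet formula (`sum_curvature`) the curvatures sum to `2`.
A vertex of a large face with `N` sides has one corner on large faces, and its face vector is one of
`{3, 3, N}`, `{3, 4, N}`, `{3, 5, N}`, `{3, 6, N}`, `{4, 4, N}`, `{3, 3, 3, N}`, so that its
curvature is at least `1 / N`. It is enough to move curvature around so that each vertex of a large
face with `N` sides ends up with at least `1 / N + 1 / 40` and all other vertices with at least `0`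
(`charge_le`): then `2 ≥ N * (1 / N + 1 / 40) = 1 + N / 40`, which contradicts `N ≥ 42`.

In units of `1 / 240`, a vertex of a large face of type `{3, 6, N}` or `{4, 4, N}` takes `6` from its
only neighbour which is not next to it along the large face, one of type `{3, 3, 3, N}` takes `3`
from each of the two such neighbours, and one of the remaining types, whose curvature is larger
than needed, gives `2` to that neighbour (`demand`). Comparing these demands with the curvature of
the paying vertex (`cost_sum_le`), two difficulties appear.

* A vertex with face vector `{4, 4, c}` or `{3, 3, 3, c}` has curvature only `1 / c`. If `c > 40`,
  the local picture propagates around the large face (`IsSquareRung.next`, `IsTriangleRung.next`):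
  the large face and the face of size `c` bound a ring of squares or triangles, which is then the
  whole graph, and `c = N`. If all vertices have the face vector of a prism or of an antiprism, the
  graph is one, by counting (`sizes_of_uniform`).
* A vertex with face vector `{3, 3, 5, 6}`, whose curvature is `8` units, may have to pay `9`
  (`IsDeficient`). It gets one unit from its neighbour along the edge between the pentagon and the
  hexagon. That neighbour is not in the same situation: otherwise two vertices of large faces would
  be joined by the edge of the hexagon opposite to that edge (`false_of_hexagon`), while a vertex of
  a large face never has to pay (`demand_nonpos_of_large`).

Throughout, the dart `d` stands also for the corner between `R.rot.symm d` and `d`, which belongs to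
the face of size `R.len d`; the two faces along the edge of `d` have sizes `R.len d` and
`R.len (R.rot d)`.
-/

/-! ### Darts, corners and the Gauss-Bonnet formula -/

namespace RotationSystem

variable {V : Type*} {G : SimpleGraph V} (R : RotationSystem G)

theorem facePerm_apply (d : G.Dart) : R.facePerm d = R.rot d.symm := rfl

theorem facePerm_dart_symm (d : G.Dart) : R.facePerm d.symm = R.rot d := by
  rw [facePerm_apply, SimpleGraph.Dart.symm_symm]

theorem facePerm_fst (d : G.Dart) : (R.facePerm d).fst = d.snd := by
  rw [facePerm_apply, R.fst_rot]; rfl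

theorem fst_rot_symm (d : G.Dart) : (R.rot.symm d).fst = d.fst := by
  conv_rhs => rw [← R.rot.apply_symm_apply d]
  rw [R.fst_rot]

theorem faceOf_eq_iff {d e : G.Dart} :
    R.faceOf d = R.faceOf e ↔ R.facePerm.SameCycle d e := Quotient.eq

theorem faceOf_facePerm (d : G.Dart) : R.faceOf (R.facePerm d) = R.faceOf d := by
  rw [faceOf_eq_iff]; exact (Equiv.Perm.sameCycle_apply_left).2 (Equiv.Perm.SameCycle.refl _ _)

theorem faceOf_facePerm_symm (d : G.Dart) : R.faceOf (R.facePerm.symm d) = R.faceOf d := by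
  conv_rhs => rw [← R.facePerm.apply_symm_apply d]
  rw [faceOf_facePerm]

theorem faceOf_rot (d : G.Dart) : R.faceOf (R.rot d) = R.faceOf d.symm := by
  rw [← facePerm_dart_symm, faceOf_facePerm]

theorem isCycleOn_face (f : R.Face) : R.facePerm.IsCycleOn {d | R.faceOf d = f} := by
  refine ⟨⟨?_, R.facePerm.injective.injOn, ?_⟩, ?_⟩
  · intro d hd; simpa [faceOf_facePerm] using hd
  · intro d hd
    exact ⟨R.facePerm.symm d, by simpa [faceOf_facePerm_symm] using hd, by simp⟩
  · intro d hd e he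
    rw [← faceOf_eq_iff]; exact hd.trans he.symm

theorem isCycleOn_vertex (v : V) : R.rot.IsCycleOn {d | d.fst = v} := by
  refine ⟨⟨?_, R.rot.injective.injOn, ?_⟩, ?_⟩
  · intro d hd; simpa [R.fst_rot] using hd
  · intro d hd
    exact ⟨R.rot.symm d, by simpa [fst_rot_symm] using hd, by simp⟩
  · intro d hd e he
    exact R.sameCycle_rot d e (hd.trans he.symm)

theorem exists_pow_facePerm [Finite G.Dart] {d e : G.Dart} (h : R.faceOf d = R.faceOf e) :
    ∃ n : ℕ, (R.facePerm ^ n) d = e := by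
  exact (R.isCycleOn_face (R.faceOf e)).exists_pow_eq' (Set.toFinite _) h rfl

theorem fst_rot_pow (d : G.Dart) (n : ℕ) : ((R.rot ^ n) d).fst = d.fst := by
  induction n with
  | zero => rfl
  | succ n ih => rw [pow_succ', Equiv.Perm.mul_apply, R.fst_rot, ih]

variable [Fintype V] [DecidableEq V] [DecidableRel G.Adj]

/-- The size of the face at the corner `d`, that is, of the face whose boundary walk passes
through `d`. -/
def len (d : G.Dart) : ℕ := R.faceSize (R.faceOf d)

theorem len_rot (d : G.Dart) : R.len (R.rot d) = R.len d.symm := by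
  rw [len, faceOf_rot, len]

theorem facePerm_pow_eq_iff (d : G.Dart) (n : ℕ) : (R.facePerm ^ n) d = d ↔ R.len d ∣ n := by
  have h : R.facePerm.IsCycleOn
      ((Finset.univ.filter fun e : G.Dart => R.faceOf e = R.faceOf d : Finset _) : Set _) := by
    simpa using R.isCycleOn_face (R.faceOf d)
  exact h.pow_apply_eq (by simp)

theorem facePerm_pow_len (d : G.Dart) : (R.facePerm ^ R.len d) d = d :=
  (R.facePerm_pow_eq_iff d _).2 dvd_rfl

theorem rot_pow_eq_iff (d : G.Dart) (n : ℕ) : (R.rot ^ n) d = d ↔ G.degree d.fst ∣ n := by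
  have h : R.rot.IsCycleOn
      ((Finset.univ.filter fun e : G.Dart => e.fst = d.fst : Finset _) : Set _) := by
    simpa using R.isCycleOn_vertex d.fst
  rw [h.pow_apply_eq (by simp), G.dart_fst_fiber_card_eq_degree]

theorem exists_dart_of_degree_pos {v : V} (h : 0 < G.degree v) : ∃ d : G.Dart, d.fst = v := by
  rw [← G.dart_fst_fiber_card_eq_degree, Finset.card_pos] at h
  obtain ⟨d, hd⟩ := h
  exact ⟨d, by simpa using hd⟩

/-- The darts issuing from a vertex, listed by successive rotations. -/
theorem darts_at_eq_map (d : G.Dart) :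
    (Finset.univ.filter fun e : G.Dart => e.fst = d.fst).val =
      (Multiset.range (G.degree d.fst)).map fun n => (R.rot ^ n) d := by
  have hinj : Set.InjOn (fun n => (R.rot ^ n) d) (Finset.range (G.degree d.fst) : Set ℕ) := by
    intro m hm n hn h
    have h' : R.rot.IsCycleOn
        ((Finset.univ.filter fun e : G.Dart => e.fst = d.fst : Finset _) : Set _) := by
      simpa using R.isCycleOn_vertex d.fst
    have := (h'.pow_apply_eq_pow_apply (by simp)).1 h
    rw [G.dart_fst_fiber_card_eq_degree] at this
    simp only [Finset.coe_range, Set.mem_Iio] at hm hn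
    exact Nat.ModEq.eq_of_lt_of_lt this hm hn
  have h : (Finset.univ.filter fun e : G.Dart => e.fst = d.fst) =
      (Finset.range (G.degree d.fst)).image fun n => (R.rot ^ n) d := by
    symm
    apply Finset.eq_of_subset_of_card_le
    · intro e he
      obtain ⟨n, -, rfl⟩ := Finset.mem_image.1 he
      simp [fst_rot_pow]
    · rw [Finset.card_image_of_injOn hinj, G.dart_fst_fiber_card_eq_degree, Finset.card_range]
  rw [h, Finset.image_val_of_injOn hinj, Finset.range_val]

theorem sum_darts_at {M : Type*} [AddCommMonoid M] (d : G.Dart) (g : G.Dart → M) :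
    ∑ e : G.Dart with e.fst = d.fst, g e =
      ∑ n ∈ Finset.range (G.degree d.fst), g ((R.rot ^ n) d) := by
  rw [Finset.sum_eq_multiset_sum, darts_at_eq_map R, Multiset.map_map]; rfl

theorem sum_darts_at_three {M : Type*} [AddCommMonoid M] {d : G.Dart} (h : G.degree d.fst = 3)
    (g : G.Dart → M) :
    ∑ e : G.Dart with e.fst = d.fst, g e = g d + g (R.rot d) + g (R.rot (R.rot d)) := by
  rw [sum_darts_at R, h]; simp [Finset.sum_range_succ, pow_succ]

theorem sum_darts_at_four {M : Type*} [AddCommMonoid M] {d : G.Dart} (h : G.degree d.fst = 4)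
    (g : G.Dart → M) :
    ∑ e : G.Dart with e.fst = d.fst, g e =
      g d + g (R.rot d) + g (R.rot (R.rot d)) + g (R.rot (R.rot (R.rot d))) := by
  rw [sum_darts_at R, h]; simp [Finset.sum_range_succ, pow_succ]

theorem sum_darts_at_five {M : Type*} [AddCommMonoid M] {d : G.Dart} (h : G.degree d.fst = 5)
    (g : G.Dart → M) :
    ∑ e : G.Dart with e.fst = d.fst, g e =
      g d + g (R.rot d) + g (R.rot (R.rot d)) + g (R.rot (R.rot (R.rot d))) +
        g (R.rot (R.rot (R.rot (R.rot d)))) := by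
  rw [sum_darts_at R, h]; simp [Finset.sum_range_succ, pow_succ]

theorem faceVector_eq_map (v : V) :
    R.faceVector v = (Finset.univ.filter fun d : G.Dart => d.fst = v).val.map R.len := by
  rw [faceVector, facesAt, Multiset.map_map]; rfl

theorem faceVector_three {d : G.Dart} (h : G.degree d.fst = 3) :
    R.faceVector d.fst = {R.len d, R.len (R.rot d), R.len (R.rot (R.rot d))} := by
  rw [faceVector_eq_map, darts_at_eq_map R, h, Multiset.map_map]
  simp [Multiset.range_succ, pow_succ, Multiset.insert_eq_cons]
  simp only [← Multiset.singleton_add, add_comm, add_assoc]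

theorem faceVector_four {d : G.Dart} (h : G.degree d.fst = 4) :
    R.faceVector d.fst = {R.len d, R.len (R.rot d), R.len (R.rot (R.rot d)),
      R.len (R.rot (R.rot (R.rot d)))} := by
  rw [faceVector_eq_map, darts_at_eq_map R, h, Multiset.map_map]
  simp [Multiset.range_succ, pow_succ, Multiset.insert_eq_cons]
  simp only [← Multiset.singleton_add, add_comm, add_assoc]

theorem rot_three {d : G.Dart} (h : G.degree d.fst = 3) : R.rot (R.rot (R.rot d)) = d := by
  have := (R.rot_pow_eq_iff d 3).2 (by rw [h])
  simpa [pow_succ] using this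

theorem rot_four {d : G.Dart} (h : G.degree d.fst = 4) :
    R.rot (R.rot (R.rot (R.rot d))) = d := by
  have := (R.rot_pow_eq_iff d 4).2 (by rw [h])
  simpa [pow_succ] using this

theorem rot_five {d : G.Dart} (h : G.degree d.fst = 5) :
    R.rot (R.rot (R.rot (R.rot (R.rot d)))) = d := by
  have := (R.rot_pow_eq_iff d 5).2 (by rw [h])
  simpa [pow_succ] using this

theorem rot_ne {d : G.Dart} (h : 3 ≤ G.degree d.fst) : R.rot d ≠ d := by
  intro e
  have := Nat.le_of_dvd one_pos ((R.rot_pow_eq_iff d 1).1 (by simpa using e))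
  omega

theorem rot_rot_ne {d : G.Dart} (h : 3 ≤ G.degree d.fst) : R.rot (R.rot d) ≠ d := by
  intro e
  have := Nat.le_of_dvd two_pos ((R.rot_pow_eq_iff d 2).1 (by simpa [pow_succ] using e))
  omega

theorem len_pos (d : G.Dart) : 0 < R.len d := by
  rw [len, faceSize, Finset.card_pos]; exact ⟨d, by simp⟩

theorem facePerm_of_len_three {d : G.Dart} (h : R.len d = 3) :
    R.facePerm (R.facePerm (R.facePerm d)) = d := by
  have := R.facePerm_pow_len d
  rw [h] at this
  simpa [pow_succ] using this

theorem facePerm_of_len_four {d : G.Dart} (h : R.len d = 4) :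
    R.facePerm (R.facePerm (R.facePerm (R.facePerm d))) = d := by
  have := R.facePerm_pow_len d
  rw [h] at this
  simpa [pow_succ] using this

theorem facePerm_of_len_six {d : G.Dart} (h : R.len d = 6) :
    R.facePerm (R.facePerm (R.facePerm (R.facePerm (R.facePerm (R.facePerm d))))) = d := by
  have := R.facePerm_pow_len d
  rw [h] at this
  simpa [pow_succ] using this

/-- In a simple graph of minimum degree `3` there are no faces of size `1` or `2`. -/
theorem three_le_len (hdeg : ∀ v : V, 3 ≤ G.degree v) (d : G.Dart) : 3 ≤ R.len d := by
  by_contra hlt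
  have hpos := R.len_pos d
  have hpow := R.facePerm_pow_len d
  obtain h | h : R.len d = 1 ∨ R.len d = 2 := by omega
  · rw [h, pow_one] at hpow
    have := R.facePerm_fst d
    rw [hpow] at this
    exact d.fst_ne_snd this
  · rw [h, pow_two, Equiv.Perm.mul_apply] at hpow
    have h1 := R.facePerm_fst d
    have h2 := R.facePerm_fst (R.facePerm d)
    rw [hpow] at h2
    have h3 : R.facePerm d = d.symm := by
      apply SimpleGraph.Dart.ext
      exact Prod.ext h1 h2.symm
    rw [facePerm_apply] at h3
    exact R.rot_ne (hdeg _) h3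

theorem curvature_eq (v : V) :
    R.curvature v = 1 - (G.degree v : ℚ) / 2 +
      ∑ d : G.Dart with d.fst = v, 1 / (R.len d : ℚ) := by
  rw [curvature, facesAt, Multiset.map_map]; rfl

theorem curvature_three {d : G.Dart} (h : G.degree d.fst = 3) :
    R.curvature d.fst = 1 / (R.len d : ℚ) + 1 / (R.len (R.rot d) : ℚ) +
      1 / (R.len (R.rot (R.rot d)) : ℚ) - 1 / 2 := by
  rw [curvature_eq, sum_darts_at_three R h, h]; push_cast; ring

theorem curvature_four {d : G.Dart} (h : G.degree d.fst = 4) :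
    R.curvature d.fst = 1 / (R.len d : ℚ) + 1 / (R.len (R.rot d) : ℚ) +
      1 / (R.len (R.rot (R.rot d)) : ℚ) + 1 / (R.len (R.rot (R.rot (R.rot d))) : ℚ) - 1 := by
  rw [curvature_eq, sum_darts_at_four R h, h]; push_cast; ring

theorem curvature_five {d : G.Dart} (h : G.degree d.fst = 5) :
    R.curvature d.fst = 1 / (R.len d : ℚ) + 1 / (R.len (R.rot d) : ℚ) +
      1 / (R.len (R.rot (R.rot d)) : ℚ) + 1 / (R.len (R.rot (R.rot (R.rot d))) : ℚ) +
      1 / (R.len (R.rot (R.rot (R.rot (R.rot d)))) : ℚ) - 3 / 2 := by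
  rw [curvature_eq, sum_darts_at_five R h, h]; push_cast; ring

/-- Reading off the number of faces of a given size from the number of darts on them. -/
theorem mul_card_faces_of_size (n : ℕ) :
    n * (Finset.univ.filter fun g : R.Face => R.faceSize g = n).card =
      (Finset.univ.filter fun d : G.Dart => R.len d = n).card := by
  rw [Finset.card_eq_sum_card_fiberwise (f := R.faceOf)
    (t := Finset.univ.filter fun g : R.Face => R.faceSize g = n)]
  · rw [Finset.sum_congr rfl (g := fun _ => n), Finset.sum_const, smul_eq_mul, mul_comm]
    intro g hg
    have hg' : R.faceSize g = n := by simpa using hg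
    rw [← hg', faceSize, Finset.filter_filter]
    congr 1
    ext d
    simp only [Finset.mem_filter, Finset.mem_univ, true_and]
    constructor
    · exact fun h => h.2
    · rintro rfl; exact ⟨rfl, rfl⟩
  · intro d hd
    simp only [Finset.coe_filter, Finset.mem_univ, true_and] at hd ⊢
    exact hd

theorem sum_one_div_len : ∑ d : G.Dart, 1 / (R.len d : ℚ) = Fintype.card R.Face := by
  rw [← Finset.sum_fiberwise Finset.univ R.faceOf, ← Finset.card_univ, Finset.card_eq_sum_ones,
    Nat.cast_sum]
  refine Finset.sum_congr rfl fun g _ => ?_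
  obtain ⟨d, rfl⟩ : ∃ d, R.faceOf d = g := Quotient.exists_rep g
  rw [Finset.sum_congr rfl (g := fun _ => 1 / (R.len d : ℚ)), Finset.sum_const]
  · change (R.len d) • _ = _
    have := R.len_pos d
    rw [nsmul_eq_mul]; push_cast; field_simp
  · intro e he
    have : R.faceOf e = R.faceOf d := by simpa using he
    rw [len, this, len]

/-- The combinatorial Gauss-Bonnet formula for the sphere. -/
theorem sum_curvature (h : R.IsSpherical) : ∑ v : V, R.curvature v = 2 := by
  simp_rw [curvature_eq]
  rw [Finset.sum_add_distrib, Finset.sum_fiberwise Finset.univ (fun d : G.Dart => d.fst),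
    sum_one_div_len, Finset.sum_sub_distrib, ← Finset.sum_div, ← Nat.cast_sum,
    G.sum_degrees_eq_twice_card_edges]
  have := h.2
  have h2 : (Fintype.card V : ℚ) - (G.edgeFinset.card : ℚ) + (Fintype.card R.Face : ℚ) = 2 := by
    exact_mod_cast this
  simp only [Finset.sum_const, Finset.card_univ, nsmul_eq_mul]
  push_cast
  linarith

end RotationSystem

/-! ### Vertices of large faces -/

namespace RotationSystem

variable {V : Type*} {G : SimpleGraph V} (R : RotationSystem G)

theorem rot_symm_fst (d : G.Dart) : (R.rot d.symm).fst = d.snd := by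
  rw [R.fst_rot]; rfl

variable [Fintype V] [DecidableEq V] [DecidableRel G.Adj]

theorem one_div_le_third {n : ℕ} (h : 3 ≤ n) : 1 / (n : ℚ) ≤ 1 / 3 :=
  one_div_le_one_div_of_le (by norm_num) (by exact_mod_cast h)

theorem one_div_le_of_le {n k : ℕ} (hk : 0 < k) (h : k ≤ n) : 1 / (n : ℚ) ≤ 1 / (k : ℚ) :=
  one_div_le_one_div_of_le (by exact_mod_cast hk) (by exact_mod_cast h)

/-- The part of the definition of a planar PCC graph that constrains single vertices. -/
structure PositivelyCurved : Prop where
  three_le_degree : ∀ v : V, 3 ≤ G.degree v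
  curvature_pos : ∀ v : V, 0 < R.curvature v

variable {R}

namespace PositivelyCurved

variable (h : R.PositivelyCurved)
include h

theorem three_le_len (d : G.Dart) : 3 ≤ R.len d := R.three_le_len h.three_le_degree d

theorem degree_le_five (v : V) : G.degree v ≤ 5 := by
  by_contra hlt
  have hK := h.curvature_pos v
  rw [curvature_eq] at hK
  have hs : ∑ d : G.Dart with d.fst = v, 1 / (R.len d : ℚ) ≤
      ∑ d : G.Dart with d.fst = v, (1 / 3 : ℚ) :=
    Finset.sum_le_sum fun d _ => one_div_le_third (h.three_le_len d)
  rw [Finset.sum_const, G.dart_fst_fiber_card_eq_degree, nsmul_eq_mul] at hs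
  have : (6 : ℚ) ≤ G.degree v := by exact_mod_cast (by omega : 6 ≤ G.degree v)
  linarith

theorem degree_cases (v : V) : G.degree v = 3 ∨ G.degree v = 4 ∨ G.degree v = 5 := by
  have := h.three_le_degree v
  have := h.degree_le_five v
  omega


theorem corners_three {d : G.Dart} (hd : G.degree d.fst = 3) :
    1 / 2 < 1 / (R.len d : ℚ) + 1 / (R.len (R.rot d) : ℚ) + 1 / (R.len (R.rot (R.rot d)) : ℚ) := by
  have := h.curvature_pos d.fst
  rw [R.curvature_three hd] at this
  linarith

theorem corners_four {d : G.Dart} (hd : G.degree d.fst = 4) :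
    1 < 1 / (R.len d : ℚ) + 1 / (R.len (R.rot d) : ℚ) + 1 / (R.len (R.rot (R.rot d)) : ℚ) +
      1 / (R.len (R.rot (R.rot (R.rot d))) : ℚ) := by
  have := h.curvature_pos d.fst
  rw [R.curvature_four hd] at this
  linarith

theorem corners_five {d : G.Dart} (hd : G.degree d.fst = 5) :
    3 / 2 < 1 / (R.len d : ℚ) + 1 / (R.len (R.rot d) : ℚ) + 1 / (R.len (R.rot (R.rot d)) : ℚ) +
      1 / (R.len (R.rot (R.rot (R.rot d))) : ℚ) +
      1 / (R.len (R.rot (R.rot (R.rot (R.rot d)))) : ℚ) := by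
  have := h.curvature_pos d.fst
  rw [R.curvature_five hd] at this
  linarith

theorem degree_of_large {d : G.Dart} (hd : 41 ≤ R.len d) :
    G.degree d.fst = 3 ∨ G.degree d.fst = 4 := by
  rcases h.degree_cases d.fst with h3 | h4 | h5
  · exact .inl h3
  · exact .inr h4
  · exfalso
    have h1 := h.corners_five h5
    have h2 := one_div_le_of_le (by norm_num) hd
    have h3 := fun e => one_div_le_third (h.three_le_len e)
    have := h3 (R.rot d)
    have := h3 (R.rot (R.rot d))
    have := h3 (R.rot (R.rot (R.rot d)))
    have := h3 (R.rot (R.rot (R.rot (R.rot d))))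
    simp only [Nat.cast_ofNat] at h2
    linarith

theorem len_of_large_of_degree_four {d : G.Dart} (hd : 41 ≤ R.len d) (h4 : G.degree d.fst = 4) :
    R.len (R.rot d) = 3 ∧ R.len (R.rot (R.rot d)) = 3 ∧
      R.len (R.rot (R.rot (R.rot d))) = 3 := by
  have h1 := h.corners_four h4
  have h2 := one_div_le_of_le (by norm_num) hd
  have h3 := fun e => one_div_le_third (h.three_le_len e)
  have h3a := h3 (R.rot d)
  have h3b := h3 (R.rot (R.rot d))
  have h3c := h3 (R.rot (R.rot (R.rot d)))
  simp only [Nat.cast_ofNat] at h2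
  refine ⟨?_, ?_, ?_⟩ <;> by_contra hne
  all_goals
    have h5 := one_div_le_of_le (k := 4) (by norm_num)
      (Nat.lt_of_le_of_ne (h.three_le_len _) (Ne.symm hne))
    simp only [Nat.cast_ofNat] at h5
    linarith

end PositivelyCurved

theorem pair_of_sum_inv {a b : ℕ} (ha : 3 ≤ a) (hb : 3 ≤ b)
    (hab : 10 / 21 < 1 / (a : ℚ) + 1 / (b : ℚ)) :
    (a = 3 ∧ b = 3) ∨ (a = 3 ∧ b = 4) ∨ (a = 4 ∧ b = 3) ∨ (a = 3 ∧ b = 5) ∨ (a = 5 ∧ b = 3) ∨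
      (a = 3 ∧ b = 6) ∨ (a = 6 ∧ b = 3) ∨ (a = 4 ∧ b = 4) := by
  have ha' : a ≤ 6 := by
    by_contra hlt
    have h1 := one_div_le_of_le (n := a) (k := 7) (by norm_num) (by omega)
    have h2 := one_div_le_third hb
    norm_num at h1 h2 hab
    linarith
  have hb' : b ≤ 6 := by
    by_contra hlt
    have h1 := one_div_le_of_le (n := b) (k := 7) (by norm_num) (by omega)
    have h2 := one_div_le_third ha
    norm_num at h1 h2 hab
    linarith
  interval_cases a <;> interval_cases b <;> first | omega | (norm_num at hab)

namespace PositivelyCurved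

variable (h : R.PositivelyCurved)
include h

theorem len_of_large_of_degree_three {d : G.Dart} (hd : 42 ≤ R.len d) (h3 : G.degree d.fst = 3) :
    (R.len (R.rot d) = 3 ∧ R.len (R.rot (R.rot d)) = 3) ∨
    (R.len (R.rot d) = 3 ∧ R.len (R.rot (R.rot d)) = 4) ∨
    (R.len (R.rot d) = 4 ∧ R.len (R.rot (R.rot d)) = 3) ∨
    (R.len (R.rot d) = 3 ∧ R.len (R.rot (R.rot d)) = 5) ∨
    (R.len (R.rot d) = 5 ∧ R.len (R.rot (R.rot d)) = 3) ∨
    (R.len (R.rot d) = 3 ∧ R.len (R.rot (R.rot d)) = 6) ∨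
    (R.len (R.rot d) = 6 ∧ R.len (R.rot (R.rot d)) = 3) ∨
    (R.len (R.rot d) = 4 ∧ R.len (R.rot (R.rot d)) = 4) := by
  apply pair_of_sum_inv (h.three_le_len _) (h.three_le_len _)
  have h1 := h.corners_three h3
  have h2 := one_div_le_of_le (by norm_num) hd
  norm_num at h1 h2 ⊢
  linarith

theorem eq_rot_of_fst_eq {d e : G.Dart} (hde : e.fst = d.fst) :
    e = d ∨ e = R.rot d ∨ e = R.rot (R.rot d) ∨
      (4 ≤ G.degree d.fst ∧ e = R.rot (R.rot (R.rot d))) ∨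
      (G.degree d.fst = 5 ∧ e = R.rot (R.rot (R.rot (R.rot d)))) := by
  have he : e ∈ (Finset.univ.filter fun e : G.Dart => e.fst = d.fst).val := by simpa using hde
  rw [R.darts_at_eq_map d] at he
  obtain ⟨n, hn, rfl⟩ := Multiset.mem_map.1 he
  have h5 := h.degree_le_five d.fst
  rw [Multiset.mem_range] at hn
  have : n = 0 ∨ n = 1 ∨ n = 2 ∨ n = 3 ∨ n = 4 := by omega
  rcases this with rfl | rfl | rfl | rfl | rfl
  · exact .inl rfl
  · exact .inr (.inl rfl)
  · exact .inr (.inr (.inl rfl))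
  · exact .inr (.inr (.inr (.inl ⟨hn, rfl⟩)))
  · exact .inr (.inr (.inr (.inr ⟨by omega, rfl⟩)))

/-- All corners but one at a vertex of a large face have size at most `6`. -/
theorem len_le_six {x e : G.Dart} (hx : 42 ≤ R.len x) (hfst : e.fst = x.fst) (hne : e ≠ x) :
    R.len e ≤ 6 := by
  rcases h.degree_of_large (by omega : 41 ≤ R.len x) with h3 | h4
  · have := h.len_of_large_of_degree_three hx h3
    rcases h.eq_rot_of_fst_eq hfst with rfl | rfl | rfl | ⟨_, rfl⟩ | ⟨_, rfl⟩
    · exact absurd rfl hne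
    all_goals omega
  · have := h.len_of_large_of_degree_four (by omega : 41 ≤ R.len x) h4
    rcases h.eq_rot_of_fst_eq hfst with rfl | rfl | rfl | ⟨_, rfl⟩ | ⟨_, rfl⟩
    · exact absurd rfl hne
    all_goals omega

theorem large_unique {x e : G.Dart} (hx : 42 ≤ R.len x) (he : 42 ≤ R.len e)
    (hfst : e.fst = x.fst) : e = x := by
  by_contra hne
  have := h.len_le_six hx hfst hne
  omega

end PositivelyCurved

theorem len_rot_symm (R : RotationSystem G) (d : G.Dart) : R.len (R.rot d.symm) = R.len d := by
  rw [len_rot, SimpleGraph.Dart.symm_symm]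

variable (R) in
/-- A dart ending at a vertex `v` of a large face (one with at least `42` sides), along an edge
which does not lie on the boundary of that face: if `x` is the dart of the large face issuing from
`v`, the edges at `v` are `x`, `R.rot x` and `R.rot (R.rot x)`, and `R.rot (R.rot (R.rot x))` in
degree four, the first and the last of them bounding the large face. -/
def IsSpoke (y : G.Dart) : Prop :=
  ∃ x : G.Dart, 42 ≤ R.len x ∧
    (y.symm = R.rot x ∨ (G.degree x.fst = 4 ∧ y.symm = R.rot (R.rot x)))

/-- The boundary walk of a triangle across the edge `x` closes up after three steps. -/
theorem triangle_next {x : G.Dart} (hx : R.len (R.rot x) = 3) :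
    R.rot (R.rot (R.rot x).symm).symm = x.symm := by
  rw [len_rot] at hx
  have := R.facePerm_of_len_three hx
  simpa [facePerm_apply] using this

namespace PositivelyCurved

variable (h : R.PositivelyCurved)
include h

/-- Of the two spokes bounding a triangle with an edge on a large face, each one determines the
other one; here from the edge at the first vertex of `x` to the edge at its last vertex. -/
theorem spoke_rot {x y : G.Dart} (hx : 42 ≤ R.len x) (hy : y.symm = R.rot x)
    (h3 : R.len (R.rot x) = 3) :
    (G.degree (R.rot x.symm).fst = 3 ∧ (R.rot y).symm = R.rot (R.rot x.symm)) ∨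
    (G.degree (R.rot x.symm).fst = 4 ∧ (R.rot y).symm = R.rot (R.rot (R.rot x.symm))) := by
  have hy' : y = (R.rot x).symm := by rw [← hy, SimpleGraph.Dart.symm_symm]
  have ht := triangle_next h3
  rw [← hy'] at ht
  have hx' : 42 ≤ R.len (R.rot x.symm) := by rwa [len_rot_symm]
  rcases h.degree_of_large (by omega : 41 ≤ R.len (R.rot x.symm)) with d3 | d4
  · refine .inl ⟨d3, R.rot.injective ?_⟩
    rw [ht]
    exact (R.rot.injective (R.rot_three d3)).symm
  · refine .inr ⟨d4, R.rot.injective ?_⟩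
    rw [ht]
    exact (R.rot.injective (R.rot_four d4)).symm

theorem isSpoke_rot {x y : G.Dart} (hx : 42 ≤ R.len x) (hy : y.symm = R.rot x)
    (h3 : R.len (R.rot x) = 3) : R.IsSpoke (R.rot y) := by
  have hx' : 42 ≤ R.len (R.rot x.symm) := by rwa [len_rot_symm]
  rcases h.spoke_rot hx hy h3 with ⟨_, e⟩ | ⟨d, e⟩
  · exact ⟨_, hx', .inl e⟩
  · exact ⟨_, hx', .inr ⟨d, e⟩⟩

omit h in
/-- The companion of `spoke_rot`, from the last vertex of the edge on the large face to the
first one. -/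
theorem spoke_rot_symm {x y : G.Dart} (hx : 42 ≤ R.len x) (hy : R.rot (R.rot y.symm) = x)
    (h3 : R.len (R.rot y.symm) = 3) :
    ∃ x', 42 ≤ R.len x' ∧ R.rot x'.symm = x ∧ R.len (R.rot x') = 3 ∧
      (R.rot.symm y).symm = R.rot x' := by
  have e1 : R.rot (R.rot y.symm).symm.symm = x := by
    rw [SimpleGraph.Dart.symm_symm, hy]
  have h3' : R.len (R.rot (R.rot y.symm).symm) = 3 := by rwa [len_rot_symm]
  refine ⟨(R.rot y.symm).symm, ?_, e1, h3', ?_⟩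
  · rwa [← e1, len_rot_symm] at hx
  · have ht := triangle_next h3'
    rw [SimpleGraph.Dart.symm_symm] at ht
    have := SimpleGraph.Dart.symm_involutive.injective (R.rot.injective ht)
    conv_lhs => rw [← this]
    rw [Equiv.symm_apply_apply, SimpleGraph.Dart.symm_symm]

end PositivelyCurved
end RotationSystem

/-! ### Prisms and antiprisms -/

namespace RotationSystem

variable {V : Type*} {G : SimpleGraph V} {R : RotationSystem G}

theorem forall_mem_of_connected (hG : G.Connected) {S : Set V} {v₀ : V} (h₀ : v₀ ∈ S)
    (hS : ∀ d : G.Dart, d.fst ∈ S → d.snd ∈ S) (v : V) : v ∈ S := by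
  obtain ⟨p⟩ := hG.preconnected v₀ v
  induction p with
  | nil => exact h₀
  | cons hadj _ ih => exact ih (hS ⟨(_, _), hadj⟩ h₀)

theorem forall_of_next [Finite G.Dart] {P : G.Dart → Prop} (hP : ∀ e, P e → P (R.rot e.symm))
    {x : G.Dart}
    (hx : P x) {e : G.Dart} (he : R.faceOf e = R.faceOf x) : P e := by
  obtain ⟨n, rfl⟩ := R.exists_pow_facePerm he.symm
  clear he
  induction n with
  | zero => exact hx
  | succ n ih => rw [pow_succ', Equiv.Perm.mul_apply]; exact hP _ ih

theorem exists_prev {x : G.Dart} (e : G.Dart) (he : R.faceOf e = R.faceOf x) :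
    ∃ e', R.faceOf e' = R.faceOf x ∧ R.rot e'.symm = e :=
  ⟨R.facePerm.symm e, by rw [faceOf_facePerm_symm, he], by
    rw [← facePerm_apply, Equiv.apply_symm_apply]⟩

variable [Fintype V] [DecidableEq V] [DecidableRel G.Adj]

theorem card_faceVector (v : V) : (R.faceVector v).card = G.degree v := by
  rw [faceVector_eq_map, Multiset.card_map]
  exact G.dart_fst_fiber_card_eq_degree v

theorem curvature_eq_faceVector (v : V) :
    R.curvature v = 1 - ((R.faceVector v).card : ℚ) / 2 +
      ((R.faceVector v).map fun n : ℕ => 1 / (n : ℚ)).sum := by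
  rw [card_faceVector, faceVector, Multiset.map_map]; rfl

theorem mul_count_faceSizes (n : ℕ) :
    n * R.faceSizes.count n = ∑ v : V, (R.faceVector v).count n := by
  have h1 : R.faceSizes.count n =
      (Finset.univ.filter fun g : R.Face => R.faceSize g = n).card := by
    rw [faceSizes, Multiset.count_map]
    simp only [eq_comm (a := n)]; rfl
  rw [h1, mul_card_faces_of_size,
    Finset.card_eq_sum_card_fiberwise (f := fun d : G.Dart => d.fst) (t := Finset.univ)
      (by intro d _; simp)]
  refine Finset.sum_congr rfl fun v _ => ?_
  rw [faceVector_eq_map, Multiset.count_map, Finset.filter_filter]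
  simp only [eq_comm (a := n)]
  rw [← Finset.filter_val, Finset.filter_filter, Finset.card_def]
  congr 2
  ext d
  simp [and_comm]

theorem count_faceSizes_zero : R.faceSizes.count 0 = 0 := by
  rw [Multiset.count_eq_zero, faceSizes, Multiset.mem_map]
  rintro ⟨g, -, hg⟩
  obtain ⟨d, rfl⟩ : ∃ d, R.faceOf d = g := Quotient.exists_rep g
  exact (R.len_pos d).ne' hg

/-- The numbers of vertices and faces of an embedding whose vertices all have the same face
vector, made of `k` faces of size `m` and one face of size `N`, and curvature `1 / N`. -/
theorem sizes_of_uniform (hS : R.IsSpherical) {k m N q : ℕ} (hm : 0 < m) (hN : m < N)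
    (hv : ∀ v, R.faceVector v = Multiset.replicate k m + {N})
    (hK : 1 - ((k : ℚ) + 1) / 2 + k / m = 0) (hq : m * q = k * (2 * N)) :
    Fintype.card V = 2 * N ∧
      R.faceSizes = Multiset.replicate 2 N + Multiset.replicate q m := by
  have hN0 : (N : ℚ) ≠ 0 := by exact_mod_cast (by omega : N ≠ 0)
  have hV : Fintype.card V = 2 * N := by
    have hsum := R.sum_curvature hS
    have hc : ∀ v, R.curvature v = 1 / N := by
      intro v
      rw [curvature_eq_faceVector, hv]
      simp only [Multiset.card_add, Multiset.card_replicate, Multiset.card_singleton,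
        Multiset.map_add, Multiset.map_replicate, Multiset.map_singleton, Multiset.sum_add,
        Multiset.sum_replicate, Multiset.sum_singleton, nsmul_eq_mul]
      push_cast
      have : (k : ℚ) * (1 / m) = k / m := by ring
      linarith
    simp only [hc, Finset.sum_const, Finset.card_univ, nsmul_eq_mul] at hsum
    field_simp at hsum
    exact_mod_cast (by linarith : (Fintype.card V : ℚ) = 2 * N)
  refine ⟨hV, ?_⟩
  ext n
  have hcount := R.mul_count_faceSizes n
  simp only [hv, Finset.sum_const, Finset.card_univ, smul_eq_mul, hV, Multiset.count_add,
    Multiset.count_replicate, Multiset.count_singleton] at hcount ⊢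
  rcases Nat.eq_zero_or_pos n with rfl | hn
  · rw [count_faceSizes_zero]
    rw [if_neg (by omega), if_neg (by omega)]
  by_cases h1 : n = N
  · subst h1
    rw [if_neg (by omega), if_pos rfl] at hcount
    rw [if_pos rfl, if_neg (by omega)]
    apply Nat.eq_of_mul_eq_mul_left hn
    omega
  by_cases h2 : n = m
  · subst h2
    rw [if_pos rfl, if_neg h1] at hcount
    rw [if_neg (fun e => h1 e.symm), if_pos rfl]
    apply Nat.eq_of_mul_eq_mul_left hn
    rw [hcount, zero_add, hq]; ring
  · rw [if_neg (fun e => h2 e.symm), if_neg h1] at hcount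
    rw [if_neg (fun e => h1 e.symm), if_neg (fun e => h2 e.symm)]
    apply Nat.eq_of_mul_eq_mul_left hn
    omega

theorem isPrism_of_faceVector (hS : R.IsSpherical) {N : ℕ} (hN : 4 < N)
    (hv : ∀ v, R.faceVector v = {4, 4, N}) : R.IsPrism N := by
  obtain ⟨h1, h2⟩ := sizes_of_uniform (k := 2) (q := N) hS (by norm_num) hN
    (fun v => (hv v).trans rfl) (by norm_num) (by ring)
  exact ⟨hS, h1, h2, hv⟩

theorem isAntiprism_of_faceVector (hS : R.IsSpherical) {N : ℕ} (hN : 3 < N)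
    (hv : ∀ v, R.faceVector v = {3, 3, 3, N}) : R.IsAntiprism N := by
  obtain ⟨h1, h2⟩ := sizes_of_uniform (k := 3) (q := 2 * N) hS (by norm_num) hN
    (fun v => (hv v).trans rfl) (by norm_num) (by ring)
  exact ⟨hS, h1, h2, hv⟩

/-- Two faces have the same size if the boundary walk of one of them corresponds, by an injective
map, to the reverse of the boundary walk of the other one. -/
theorem len_eq_of_reverse {θ : G.Dart → G.Dart} (hθ : Function.Injective θ) {x : G.Dart}
    (h : ∀ e, R.faceOf e = R.faceOf x → R.facePerm (θ (R.facePerm e)) = θ e) :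
    R.len (θ x) = R.len x := by
  have hface : ∀ n : ℕ, R.faceOf ((R.facePerm ^ n) x) = R.faceOf x := by
    intro n
    induction n with
    | zero => rfl
    | succ n ih => rw [pow_succ', Equiv.Perm.mul_apply, faceOf_facePerm, ih]
  have hpow : ∀ n : ℕ, (R.facePerm ^ n) (θ ((R.facePerm ^ n) x)) = θ x := by
    intro n
    induction n with
    | zero => rfl
    | succ n ih =>
      rw [pow_succ, Equiv.Perm.mul_apply, ← pow_succ, pow_succ', Equiv.Perm.mul_apply,
        h _ (hface n), ih]
  apply Nat.dvd_antisymm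
  · rw [← facePerm_pow_eq_iff]
    have := hpow (R.len x)
    rwa [facePerm_pow_len] at this
  · rw [← facePerm_pow_eq_iff]
    have := hpow (R.len (θ x))
    conv_rhs at this => rw [← R.facePerm_pow_len (θ x)]
    exact hθ ((R.facePerm ^ _).injective this)

theorem IsSpoke.len_le_six (h : R.PositivelyCurved) {y : G.Dart} (hy : R.IsSpoke y) :
    R.len y ≤ 6 ∧ R.len (R.rot y) ≤ 6 := by
  obtain ⟨x, hx, hyx⟩ := hy
  have e1 : R.len y = R.len (R.rot y.symm) := (R.len_rot_symm y).symm
  have e2 : R.len (R.rot y) = R.len y.symm := R.len_rot y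
  have key : ∀ e : G.Dart, e.fst = x.fst → e ≠ x → R.len e ≤ 6 := fun e => h.len_le_six hx
  have hd := h.three_le_degree x.fst
  have n1 := R.rot_ne hd
  have n2 := R.rot_rot_ne hd
  rcases hyx with e | ⟨d, e⟩
  · rw [e1, e2, e]
    exact ⟨key _ (by simp [R.fst_rot]) n2, key _ (by simp [R.fst_rot]) n1⟩
  · rw [e1, e2, e]
    refine ⟨key _ (by simp [R.fst_rot]) ?_, key _ (by simp [R.fst_rot]) n2⟩
    intro e3
    have := R.rot_four d
    rw [e3] at this
    exact n1 this

/-- The boundary walk of a quadrilateral across the edge `x` closes up after four steps. -/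
theorem square_next {x : G.Dart} (hx : R.len (R.rot x) = 4) :
    R.rot (R.rot (R.rot (R.rot x).symm).symm).symm = x.symm := by
  rw [len_rot] at hx
  have := R.facePerm_of_len_four hx
  simpa [facePerm_apply] using this

variable (R) in
/-- One rung of a ring of squares around the large face of `x`: the edges next to `x.fst` along
the large face border squares, and the third neighbour of `x.fst` has face vector `{4, 4, c}`. -/
structure IsSquareRung (c : ℕ) (x : G.Dart) : Prop where
  large : 42 ≤ R.len x
  degree : G.degree x.fst = 3
  len_rot : R.len (R.rot x) = 4
  len_rot_rot : R.len (R.rot (R.rot x)) = 4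
  degree_opp : G.degree (R.rot x).symm.fst = 3
  len_opp : R.len (R.rot (R.rot (R.rot x).symm)) = c

theorem IsSquareRung.next (h : R.PositivelyCurved) {c : ℕ} (hc : 41 ≤ c) {x : G.Dart}
    (hx : R.IsSquareRung c x) :
    R.IsSquareRung c (R.rot x.symm) ∧
      R.rot (R.rot (R.rot x).symm).symm = (R.rot (R.rot x.symm)).symm := by
  obtain ⟨hN, -, h4, -, -, hopp⟩ := hx
  set y := (R.rot x).symm with hy
  set x' := R.rot x.symm with hx'
  have hN' : 42 ≤ R.len x' := by rwa [hx', len_rot_symm]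
  have hlen : R.len x.symm = 4 := by rw [← RotationSystem.len_rot, h4]
  have d3 : G.degree x'.fst = 3 := by
    rcases h.degree_of_large (by omega : 41 ≤ R.len x') with d | d
    · exact d
    · have e := h.len_of_large_of_degree_four (by omega : 41 ≤ R.len x') d
      have e' : R.rot (R.rot (R.rot x')) = x.symm := R.rot.injective (R.rot_four d)
      rw [e'] at e
      omega
  have e2 : R.rot (R.rot x') = x.symm := R.rot.injective (R.rot_three d3)
  have hsq := square_next h4
  have hy' : R.rot (R.rot y).symm = (R.rot x').symm := by
    have : (R.rot (R.rot y).symm).symm = R.rot x' := R.rot.injective (hsq.trans e2.symm)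
    rw [← this, SimpleGraph.Dart.symm_symm]
  have hz : R.len (R.rot y).symm = c := by rw [← RotationSystem.len_rot, hopp]
  have hlen' : R.len (R.rot (R.rot y).symm) = 4 := by
    rw [hy', ← RotationSystem.len_rot_symm, SimpleGraph.Dart.symm_symm, e2, hlen]
  have dz : G.degree (R.rot y).symm.fst = 3 := by
    rcases h.degree_of_large (by omega : 41 ≤ R.len (R.rot y).symm) with d | d
    · exact d
    · have e := h.len_of_large_of_degree_four (by omega : 41 ≤ R.len (R.rot y).symm) d
      omega
  have hcorner : R.len (R.rot (R.rot (R.rot x').symm)) = c := by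
    rw [← hy', R.rot_three dz, hz]
  have hdeg : G.degree (R.rot x').symm.fst = 3 := by
    rw [← hy', R.fst_rot, dz]
  refine ⟨⟨hN', d3, ?_, by rw [e2, hlen], hdeg, hcorner⟩, hy'⟩
  have hcl := h.len_of_large_of_degree_three hN' d3
  rw [e2, hlen] at hcl
  by_contra h4'
  have h3 : R.len (R.rot x') = 3 := by omega
  have := (h.isSpoke_rot hN' (SimpleGraph.Dart.symm_symm _) h3).len_le_six h
  omega

variable (R) in
/-- One rung of a ring of triangles around the large face of `x`: the vertex `x.fst` has face
vector `{3, 3, 3, N}`, and the third vertex of the triangle across `x` has degree four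
and a corner of size `c`, which makes its face vector `{3, 3, 3, c}` when `c` is at least `41`. -/
structure IsTriangleRung (c : ℕ) (x : G.Dart) : Prop where
  large : 42 ≤ R.len x
  degree : G.degree x.fst = 4
  degree_opp : G.degree (R.rot x).symm.fst = 4
  len_opp : R.len (R.rot (R.rot (R.rot (R.rot x).symm))) = c

theorem IsTriangleRung.next (h : R.PositivelyCurved) {c : ℕ} (hc : 41 ≤ c) {x : G.Dart}
    (hx : R.IsTriangleRung c x) :
    R.IsTriangleRung c (R.rot x.symm) ∧
      (R.rot (R.rot x).symm).symm = R.rot (R.rot (R.rot x.symm)) ∧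
      R.rot (R.rot (R.rot (R.rot x).symm)).symm = (R.rot (R.rot x.symm)).symm := by
  obtain ⟨hN, d4, dy, hopp⟩ := hx
  have h3 := (h.len_of_large_of_degree_four (by omega) d4).1
  have hsp := h.spoke_rot (y := (R.rot x).symm) hN (SimpleGraph.Dart.symm_symm _) h3
  set y := (R.rot x).symm with hy
  set x' := R.rot x.symm with hx'
  have hN' : 42 ≤ R.len x' := by rwa [hx', len_rot_symm]
  have hz : R.len (R.rot (R.rot y)).symm = c := by rw [← RotationSystem.len_rot, hopp]
  have hy4 := R.rot_four dy
  -- the corners at the vertex of `y` other than the large one are triangles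
  have hy3 : R.len (R.rot (R.rot y)) = 3 := by
    have e := h.len_of_large_of_degree_four (d := R.rot (R.rot (R.rot y))) (by omega)
      (by rw [R.fst_rot, R.fst_rot, R.fst_rot, dy])
    rw [hy4] at e
    exact e.2.2
  rcases hsp with ⟨d3, e⟩ | ⟨d4', e⟩
  · exfalso
    have : R.len (R.rot x') = 3 := by rw [← e, ← RotationSystem.len_rot, hy3]
    have := (h.isSpoke_rot hN' e this).len_le_six h
    omega
  refine ⟨?_, e, ?_⟩
  all_goals
    have hM : R.len (R.rot (R.rot x')) = 3 := (h.len_of_large_of_degree_four (by omega) d4').2.1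
    have ht := R.facePerm_of_len_three hM
    simp only [facePerm_apply, ← e, SimpleGraph.Dart.symm_symm] at ht
    rw [e] at ht
    have hyz : R.rot (R.rot (R.rot y)).symm = (R.rot x').symm := by
      rw [← R.rot.injective ht, SimpleGraph.Dart.symm_symm]
  · have hd : G.degree (R.rot (R.rot y)).symm.fst = 4 := by
      rcases h.degree_of_large (by omega : 41 ≤ R.len (R.rot (R.rot y)).symm) with d | d
      · exfalso
        have h3' := (h.len_of_large_of_degree_four (by omega) d4').1
        have := (h.isSpoke_rot hN' (SimpleGraph.Dart.symm_symm _) h3').len_le_six h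
        rw [← hyz, R.rot_three d] at this
        omega
      · exact d
    refine ⟨hN', d4', ?_, ?_⟩
    · rw [← hyz, R.fst_rot, hd]
    · rw [← hyz, R.rot_four hd, hz]
  · exact hyz

theorem IsPlanarPCC.positivelyCurved (hR : R.IsPlanarPCC) : R.PositivelyCurved :=
  ⟨hR.three_le_degree, hR.curvature_pos⟩

theorem IsPlanarPCC.not_isSquareRung (hR : R.IsPlanarPCC) {c : ℕ} (hc : 41 ≤ c) (x : G.Dart) :
    ¬ R.IsSquareRung c x := by
  intro hx
  have h := hR.positivelyCurved
  have hall : ∀ e, R.faceOf e = R.faceOf x → R.IsSquareRung c e := fun e he =>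
    forall_of_next (fun e he => (he.next h hc).1) hx he
  have hnext : ∀ e, R.faceOf e = R.faceOf x → R.faceOf (R.rot e.symm) = R.faceOf x := fun e he => by
    rw [← facePerm_apply, faceOf_facePerm, he]
  have hlen : c = R.len x := by
    have hinj : Function.Injective fun e : G.Dart => R.rot (R.rot (R.rot e).symm) :=
      R.rot.injective.comp (R.rot.injective.comp
        (SimpleGraph.Dart.symm_involutive.injective.comp R.rot.injective))
    rw [← len_eq_of_reverse (R := R) hinj (x := x), hx.len_opp]
    intro e he
    have h1 := (hall e he).next h hc
    have h2 := R.rot_three h1.1.degree_opp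
    rw [← h1.2] at h2
    change R.rot (R.rot (R.rot (R.rot (R.rot e.symm)).symm)).symm = _
    rw [← h1.2, R.rot.injective h2, SimpleGraph.Dart.symm_symm]
  refine hR.not_prism c (isPrism_of_faceVector hR.spherical (by omega) ?_)
  have key : ∀ v, v ∈ {v | ∃ e, R.faceOf e = R.faceOf x ∧
      (e.fst = v ∨ (R.rot e).symm.fst = v)} := by
    refine forall_mem_of_connected hR.spherical.1 (v₀ := x.fst) ⟨x, rfl, .inl rfl⟩ ?_
    rintro d ⟨e, he, hd | hd⟩
    · have hr := hall e he
      rcases h.eq_rot_of_fst_eq hd.symm with rfl | rfl | rfl | ⟨h4, _⟩ | ⟨h5, _⟩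
      · exact ⟨_, hnext _ he, .inl (R.rot_symm_fst _)⟩
      · exact ⟨e, he, .inr rfl⟩
      · obtain ⟨e', he', rfl⟩ := exists_prev e he
        refine ⟨e', he', .inl ?_⟩
        rw [R.rot.injective (R.rot_three hr.degree)]; rfl
      · have := hr.degree; omega
      · have := hr.degree; omega
    · have hr := hall e he
      rcases h.eq_rot_of_fst_eq hd.symm with rfl | rfl | rfl | ⟨h4, _⟩ | ⟨h5, _⟩
      · exact ⟨e, he, .inl (R.fst_rot e).symm⟩
      · refine ⟨_, hnext _ he, .inr ?_⟩
        rw [← (hr.next h hc).2, rot_symm_fst]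
      · obtain ⟨e', he', rfl⟩ := exists_prev e he
        refine ⟨e', he', .inr ?_⟩
        have h1 := (hall e' he').next h hc
        have h2 := R.rot_three hr.degree_opp
        rw [← h1.2] at h2 ⊢
        rw [R.rot.injective h2]
        exact (R.fst_rot _).symm
      · have := hr.degree_opp; omega
      · have := hr.degree_opp; omega
  intro v
  obtain ⟨e, he, rfl | rfl⟩ := key v
  · have hr := hall e he
    rw [R.faceVector_three hr.degree, hr.len_rot, hr.len_rot_rot]
    have : R.len e = c := by rw [hlen, len, he, len]
    rw [this]
    simp only [Multiset.insert_eq_cons, ← Multiset.singleton_add, add_comm, add_left_comm]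
  · have hr := hall e he
    rw [R.faceVector_three hr.degree_opp, hr.len_opp]
    have e1 : R.len (R.rot e).symm = 4 := by rw [← len_rot, hr.len_rot_rot]
    have e2 : R.len (R.rot (R.rot e).symm) = 4 := by rw [len_rot_symm, hr.len_rot]
    rw [e1, e2]

theorem IsPlanarPCC.not_isTriangleRung (hR : R.IsPlanarPCC) {c : ℕ} (hc : 41 ≤ c) (x : G.Dart) :
    ¬ R.IsTriangleRung c x := by
  intro hx
  have h := hR.positivelyCurved
  have hall : ∀ e, R.faceOf e = R.faceOf x → R.IsTriangleRung c e := fun e he =>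
    forall_of_next (fun e he => (he.next h hc).1) hx he
  have hnext : ∀ e, R.faceOf e = R.faceOf x → R.faceOf (R.rot e.symm) = R.faceOf x := fun e he => by
    rw [← facePerm_apply, faceOf_facePerm, he]
  have hlen : c = R.len x := by
    have hinj : Function.Injective fun e : G.Dart => R.rot (R.rot (R.rot (R.rot e).symm)) :=
      R.rot.injective.comp (R.rot.injective.comp (R.rot.injective.comp
        (SimpleGraph.Dart.symm_involutive.injective.comp R.rot.injective)))
    rw [← len_eq_of_reverse (R := R) hinj (x := x), hx.len_opp]
    intro e he
    have h1 := (hall e he).next h hc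
    have h2 := R.rot_four h1.1.degree_opp
    rw [← h1.2.2] at h2
    change R.rot (R.rot (R.rot (R.rot (R.rot (R.rot e.symm)).symm))).symm = _
    rw [← h1.2.2, R.rot.injective h2, SimpleGraph.Dart.symm_symm]
  refine hR.not_antiprism c (isAntiprism_of_faceVector hR.spherical (by omega) ?_)
  have key : ∀ v, v ∈ {v | ∃ e, R.faceOf e = R.faceOf x ∧
      (e.fst = v ∨ (R.rot e).symm.fst = v)} := by
    refine forall_mem_of_connected hR.spherical.1 (v₀ := x.fst) ⟨x, rfl, .inl rfl⟩ ?_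
    rintro d ⟨e, he, hd | hd⟩
    · have hr := hall e he
      rcases h.eq_rot_of_fst_eq hd.symm with rfl | rfl | rfl | ⟨-, rfl⟩ | ⟨h5, _⟩
      · exact ⟨_, hnext _ he, .inl (R.rot_symm_fst _)⟩
      · exact ⟨e, he, .inr rfl⟩
      · obtain ⟨e', he', rfl⟩ := exists_prev e he
        refine ⟨e', he', .inr ?_⟩
        rw [← ((hall e' he').next h hc).2.1]
        exact (R.fst_rot _).symm
      · obtain ⟨e', he', rfl⟩ := exists_prev e he
        refine ⟨e', he', .inl ?_⟩
        rw [R.rot.injective (R.rot_four hr.degree)]; rfl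
      · have := hr.degree; omega
    · have hr := hall e he
      have hn := hr.next h hc
      rcases h.eq_rot_of_fst_eq hd.symm with rfl | rfl | rfl | ⟨-, rfl⟩ | ⟨h5, _⟩
      · exact ⟨e, he, .inl (R.fst_rot e).symm⟩
      · refine ⟨_, hnext _ he, .inl ?_⟩
        change _ = (R.rot (R.rot e).symm).symm.fst
        rw [hn.2.1]; simp only [R.fst_rot]
      · refine ⟨_, hnext _ he, .inr ?_⟩
        rw [← hn.2.2, rot_symm_fst]
      · obtain ⟨e', he', rfl⟩ := exists_prev e he
        refine ⟨e', he', .inr ?_⟩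
        have h1 := (hall e' he').next h hc
        have h2 := R.rot_four hr.degree_opp
        rw [← h1.2.2] at h2 ⊢
        rw [R.rot.injective h2]
        change _ = (R.rot (R.rot (R.rot e').symm)).fst
        rw [R.fst_rot, R.fst_rot]
      · have := hr.degree_opp; omega
  intro v
  obtain ⟨e, he, rfl | rfl⟩ := key v
  · have hr := hall e he
    have h3 := h.len_of_large_of_degree_four (by have := hr.large; omega) hr.degree
    rw [R.faceVector_four hr.degree, h3.1, h3.2.1, h3.2.2]
    have : R.len e = c := by rw [hlen, len, he, len]
    rw [this]
    simp only [Multiset.insert_eq_cons, ← Multiset.singleton_add, add_comm, add_left_comm]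
  · have hr := hall e he
    have hy4 := R.rot_four hr.degree_opp
    have h3 := h.len_of_large_of_degree_four (d := R.rot (R.rot (R.rot (R.rot e).symm)))
      (by have := hr.len_opp; omega) (by rw [R.fst_rot, R.fst_rot, R.fst_rot, hr.degree_opp])
    rw [hy4] at h3
    rw [R.faceVector_four hr.degree_opp, hr.len_opp, h3.1, h3.2.1, h3.2.2]

end RotationSystem

/-! ### Demands of the vertices of large faces -/

namespace RotationSystem

variable {V : Type*} {G : SimpleGraph V} {R : RotationSystem G}
theorem snd_eq_of_symm_eq_rot {x y : G.Dart} (e : y.symm = R.rot x) : y.snd = x.fst := by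
  rw [← R.fst_rot x, ← e]; rfl

theorem snd_eq_of_symm_eq_rot_rot {x y : G.Dart} (e : y.symm = R.rot (R.rot x)) :
    y.snd = x.fst := by
  rw [snd_eq_of_symm_eq_rot e, R.fst_rot]

variable [Fintype V] [DecidableEq V] [DecidableRel G.Adj]

open Classical in
variable (R) in
/-- The charge which the end point of `y`, a vertex of a large face, demands from the initial
vertex of `y`, in units of `1 / 240`; a negative value is a gift. -/
noncomputable def demand (y : G.Dart) : ℚ :=
  if R.IsSpoke y then
    if G.degree y.snd = 4 then 3
    else if (R.len y = 3 ∧ R.len (R.rot y) = 6) ∨ (R.len y = 6 ∧ R.len (R.rot y) = 3) ∨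
      (R.len y = 4 ∧ R.len (R.rot y) = 4) then 6
    else -2
  else 0

theorem demand_of_not_isSpoke {y : G.Dart} (hy : ¬ R.IsSpoke y) : R.demand y = 0 := if_neg hy

theorem isSpoke_of_demand_pos {y : G.Dart} (hy : 0 < R.demand y) : R.IsSpoke y := by
  by_contra hn
  rw [demand_of_not_isSpoke hn] at hy
  exact lt_irrefl _ hy

theorem IsSpoke.cases (h : R.PositivelyCurved) {y : G.Dart} (hy : R.IsSpoke y) :
    (∃ x : G.Dart, 42 ≤ R.len x ∧ G.degree x.fst = 3 ∧ y.symm = R.rot x) ∨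
    (∃ x : G.Dart, 42 ≤ R.len x ∧ G.degree x.fst = 4 ∧ y.symm = R.rot x) ∨
    (∃ x : G.Dart, 42 ≤ R.len x ∧ G.degree x.fst = 4 ∧ y.symm = R.rot (R.rot x)) := by
  obtain ⟨x, hx, e | ⟨d, e⟩⟩ := hy
  · rcases h.degree_of_large (by omega : 41 ≤ R.len x) with d | d
    · exact .inl ⟨x, hx, d, e⟩
    · exact .inr (.inl ⟨x, hx, d, e⟩)
  · exact .inr (.inr ⟨x, hx, d, e⟩)

theorem len_of_symm_eq_rot {x y : G.Dart} (e : y.symm = R.rot x) :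
    R.len y = R.len (R.rot (R.rot x)) ∧ R.len (R.rot y) = R.len (R.rot x) := by
  rw [← e, len_rot_symm, len_rot]
  exact ⟨rfl, rfl⟩

/-- The sizes of the faces along a spoke ending at a vertex of degree three. -/
theorem len_of_spoke_three (h : R.PositivelyCurved) {x y : G.Dart} (hx : 42 ≤ R.len x)
    (d : G.degree x.fst = 3) (e : y.symm = R.rot x) :
    (R.len y = 3 ∧ R.len (R.rot y) = 3) ∨
    (R.len y = 3 ∧ R.len (R.rot y) = 4) ∨ (R.len y = 4 ∧ R.len (R.rot y) = 3) ∨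
    (R.len y = 3 ∧ R.len (R.rot y) = 5) ∨ (R.len y = 5 ∧ R.len (R.rot y) = 3) ∨
    (R.len y = 3 ∧ R.len (R.rot y) = 6) ∨ (R.len y = 6 ∧ R.len (R.rot y) = 3) ∨
    (R.len y = 4 ∧ R.len (R.rot y) = 4) := by
  have hcl := h.len_of_large_of_degree_three hx d
  rw [(len_of_symm_eq_rot e).1, (len_of_symm_eq_rot e).2]
  omega

theorem len_of_spoke_four (h : R.PositivelyCurved) {x y : G.Dart} (hx : 42 ≤ R.len x)
    (d : G.degree x.fst = 4) (e : y.symm = R.rot x ∨ y.symm = R.rot (R.rot x)) :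
    R.len y = 3 ∧ R.len (R.rot y) = 3 := by
  have hcl := h.len_of_large_of_degree_four (by omega) d
  rcases e with e | e <;> rw [(len_of_symm_eq_rot e).1, (len_of_symm_eq_rot e).2] <;> omega

theorem demand_of_degree_four {x y : G.Dart} (hx : 42 ≤ R.len x)
    (d : G.degree x.fst = 4) (e : y.symm = R.rot x ∨ y.symm = R.rot (R.rot x)) :
    R.demand y = 3 := by
  have hsp : R.IsSpoke y := ⟨x, hx, e.imp_right fun e => ⟨d, e⟩⟩
  have hsnd : y.snd = x.fst := e.elim snd_eq_of_symm_eq_rot snd_eq_of_symm_eq_rot_rot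
  rw [demand, if_pos hsp, if_pos (by rw [hsnd, d])]

theorem demand_of_degree_three {x y : G.Dart} (hx : 42 ≤ R.len x)
    (d : G.degree x.fst = 3) (e : y.symm = R.rot x) :
    R.demand y =
      if (R.len y = 3 ∧ R.len (R.rot y) = 6) ∨ (R.len y = 6 ∧ R.len (R.rot y) = 3) ∨
      (R.len y = 4 ∧ R.len (R.rot y) = 4) then 6 else -2 := by
  have hsp : R.IsSpoke y := ⟨x, hx, .inl e⟩
  rw [demand, if_pos hsp, if_neg (by rw [snd_eq_of_symm_eq_rot e, d]; norm_num)]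

/-- The possible sizes of the faces along a spoke, and the demand in each case. -/
theorem IsSpoke.demand_cases (h : R.PositivelyCurved) {y : G.Dart} (hy : R.IsSpoke y) :
    (R.len y = 3 ∧ R.len (R.rot y) = 3 ∧ R.demand y ≤ 3) ∨
    (R.len y = 3 ∧ R.len (R.rot y) = 4 ∧ R.demand y = -2) ∨
    (R.len y = 4 ∧ R.len (R.rot y) = 3 ∧ R.demand y = -2) ∨
    (R.len y = 3 ∧ R.len (R.rot y) = 5 ∧ R.demand y = -2) ∨
    (R.len y = 5 ∧ R.len (R.rot y) = 3 ∧ R.demand y = -2) ∨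
    (R.len y = 3 ∧ R.len (R.rot y) = 6 ∧ R.demand y = 6) ∨
    (R.len y = 6 ∧ R.len (R.rot y) = 3 ∧ R.demand y = 6) ∨
    (R.len y = 4 ∧ R.len (R.rot y) = 4 ∧ R.demand y = 6) := by
  rcases hy.cases h with ⟨x, hx, d, e⟩ | ⟨x, hx, d, e⟩ | ⟨x, hx, d, e⟩
  · have hdem := demand_of_degree_three hx d e
    rcases len_of_spoke_three h hx d e with hl | hl | hl | hl | hl | hl | hl | hl <;>
      (simp only [hl.1, hl.2] at hdem ⊢; norm_num at hdem ⊢; rw [hdem]; try norm_num)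
  · have hl := len_of_spoke_four h hx d (.inl e)
    exact .inl ⟨hl.1, hl.2, (demand_of_degree_four hx d (.inl e)).le⟩
  · have hl := len_of_spoke_four h hx d (.inr e)
    exact .inl ⟨hl.1, hl.2, (demand_of_degree_four hx d (.inr e)).le⟩

theorem isSpoke_rot_symm {x y : G.Dart} (hx : 42 ≤ R.len x) (hy : R.rot (R.rot y.symm) = x)
    (h3 : R.len y = 3) : R.IsSpoke (R.rot.symm y) := by
  obtain ⟨x', hx', -, -, e⟩ := PositivelyCurved.spoke_rot_symm hx hy (by rw [len_rot_symm, h3])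
  exact ⟨x', hx', .inl e⟩

/-- A triangle along a spoke whose other face is not a triangle has a second spoke, on the other
side; if both faces are triangles then at least one of them has a second spoke. -/
theorem IsSpoke.adjacent (h : R.PositivelyCurved) {y : G.Dart} (hy : R.IsSpoke y) :
    (R.len y = 3 → R.len (R.rot y) ≠ 3 → R.IsSpoke (R.rot.symm y)) ∧
    (R.len (R.rot y) = 3 → R.len y ≠ 3 → R.IsSpoke (R.rot y)) ∧
    (R.len y = 3 → R.len (R.rot y) = 3 → R.IsSpoke (R.rot.symm y) ∨ R.IsSpoke (R.rot y)) := by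
  rcases hy.cases h with ⟨x, hx, d, e⟩ | ⟨x, hx, d, e⟩ | ⟨x, hx, d, e⟩
  · have h1 : R.len (R.rot y) = 3 → R.IsSpoke (R.rot y) := fun h3 =>
      h.isSpoke_rot hx e (by rw [← (len_of_symm_eq_rot e).2, h3])
    have h2 : R.len y = 3 → R.IsSpoke (R.rot.symm y) := fun h3 =>
      isSpoke_rot_symm hx (by rw [e, R.rot_three d]) h3
    exact ⟨fun a _ => h2 a, fun a _ => h1 a, fun a _ => .inl (h2 a)⟩
  · have hl := len_of_spoke_four h hx d (.inl e)
    refine ⟨fun _ b => absurd hl.2 b, fun _ b => absurd hl.1 b, fun _ h3 => .inr ?_⟩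
    exact h.isSpoke_rot hx e (by rw [← (len_of_symm_eq_rot e).2, h3])
  · have hl := len_of_spoke_four h hx d (.inr e)
    refine ⟨fun _ b => absurd hl.2 b, fun _ b => absurd hl.1 b, fun h3 _ => .inl ?_⟩
    exact isSpoke_rot_symm hx (by rw [e, R.rot_four d]) h3

/-- If a spoke from a vertex of degree three borders a triangle, the third face at this vertex is
next to a second spoke, so it has at most six sides. -/
theorem IsSpoke.len_le_six_of_degree_three (h : R.PositivelyCurved) {y : G.Dart}
    (hy : R.IsSpoke y) (d : G.degree y.fst = 3) (h3 : R.len y = 3 ∨ R.len (R.rot y) = 3) :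
    R.len (R.rot (R.rot y)) ≤ 6 := by
  have e : R.rot.symm y = R.rot (R.rot y) := by rw [Equiv.symm_apply_eq, R.rot_three d]
  have h1 : R.IsSpoke (R.rot.symm y) → R.len (R.rot (R.rot y)) ≤ 6 := fun hs => by
    rw [← e]; exact (hs.len_le_six h).1
  have h2 : R.IsSpoke (R.rot y) → R.len (R.rot (R.rot y)) ≤ 6 := fun hs => (hs.len_le_six h).2
  obtain ⟨a1, a2, a3⟩ := hy.adjacent h
  by_cases b1 : R.len y = 3 <;> by_cases b2 : R.len (R.rot y) = 3
  · exact (a3 b1 b2).elim h1 h2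
  · exact h1 (a1 b1 b2)
  · exact h2 (a2 b2 b1)
  · omega

theorem IsSpoke.len_le_of_squares (hR : R.IsPlanarPCC) {y : G.Dart} (hy : R.IsSpoke y)
    (d : G.degree y.fst = 3) (h1 : R.len y = 4) (h2 : R.len (R.rot y) = 4) :
    R.len (R.rot (R.rot y)) ≤ 40 := by
  have h := hR.positivelyCurved
  rcases hy.cases h with ⟨x, hx, dx, e⟩ | ⟨x, hx, dx, e⟩ | ⟨x, hx, dx, e⟩
  · by_contra hlt
    have e' : (R.rot x).symm = y := by rw [← e, SimpleGraph.Dart.symm_symm]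
    refine hR.not_isSquareRung (c := R.len (R.rot (R.rot y))) (by omega) x
      ⟨hx, dx, ?_, ?_, by rw [e', d], by rw [e']⟩
    · rw [← (len_of_symm_eq_rot e).2, h2]
    · rw [← (len_of_symm_eq_rot e).1, h1]
  · have := len_of_spoke_four h hx dx (.inl e); omega
  · have := len_of_spoke_four h hx dx (.inr e); omega

theorem cases_of_demand_pos_of_triangles (h : R.PositivelyCurved) {y : G.Dart}
    (hy : 0 < R.demand y) (h1 : R.len y = 3) (h2 : R.len (R.rot y) = 3) :
    (∃ x : G.Dart, 42 ≤ R.len x ∧ G.degree x.fst = 4 ∧ y.symm = R.rot x) ∨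
    (∃ x : G.Dart, 42 ≤ R.len x ∧ G.degree x.fst = 4 ∧ y.symm = R.rot (R.rot x)) := by
  rcases (isSpoke_of_demand_pos hy).cases h with ⟨x, hx, d, e⟩ | h' | h'
  · rw [demand_of_degree_three hx d e, h1, h2] at hy
    norm_num at hy
  · exact .inl h'
  · exact .inr h'

theorem len_le_of_triangles (hR : R.IsPlanarPCC) {y : G.Dart} (d : G.degree y.fst = 4)
    (h1 : R.len y = 3) (h2 : R.len (R.rot y) = 3) (h3 : R.len (R.rot (R.rot y)) = 3)
    (hdem : 0 < R.demand y ∨ 0 < R.demand (R.rot y)) :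
    R.len (R.rot (R.rot (R.rot y))) ≤ 40 := by
  have h := hR.positivelyCurved
  by_contra hlt
  have hprev : R.rot.symm y = R.rot (R.rot (R.rot y)) := by
    rw [Equiv.symm_apply_eq, R.rot_four d]
  have hrung : ∀ x : G.Dart, 42 ≤ R.len x → G.degree x.fst = 4 → y.symm = R.rot x → False := by
    intro x hx dx e
    have e' : (R.rot x).symm = y := by rw [← e, SimpleGraph.Dart.symm_symm]
    exact hR.not_isTriangleRung (c := R.len (R.rot (R.rot (R.rot y)))) (by omega) x
      ⟨hx, dx, by rw [e', d], by rw [e']⟩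
  rcases hdem with hy | hy
  · rcases cases_of_demand_pos_of_triangles h hy h1 h2 with ⟨x, hx, dx, e⟩ | ⟨x, hx, dx, e⟩
    · exact hrung x hx dx e
    · have := ((isSpoke_rot_symm hx (by rw [e, R.rot_four dx]) h1).len_le_six h).1
      rw [hprev] at this
      omega
  · rcases cases_of_demand_pos_of_triangles h hy h2 h3 with ⟨x, hx, dx, e⟩ | ⟨x, hx, dx, e⟩
    · have := ((h.isSpoke_rot hx e (by rw [← (len_of_symm_eq_rot e).2, h3])).len_le_six h).2
      omega
    · obtain ⟨x', hx', -, hl, e'⟩ := PositivelyCurved.spoke_rot_symm hx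
        (by rw [e, R.rot_four dx]) (by rw [len_rot_symm, h2])
      rw [Equiv.symm_apply_apply] at e'
      rcases h.degree_of_large (by omega : 41 ≤ R.len x') with dx' | dx'
      · have := ((isSpoke_rot_symm hx' (by rw [e', R.rot_three dx']) h1).len_le_six h).1
        rw [hprev] at this
        omega
      · exact hrung x' hx' dx' e'

/-- Nothing is demanded from the vertices of a large face. -/
theorem demand_nonpos_of_large (hR : R.IsPlanarPCC) {x y : G.Dart} (hx : 42 ≤ R.len x)
    (hxy : y.fst = x.fst) : R.demand y ≤ 0 := by
  have h := hR.positivelyCurved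
  by_contra! hpos
  have hsp := isSpoke_of_demand_pos hpos
  have h6 := hsp.len_le_six h
  rcases h.degree_of_large (by omega : 41 ≤ R.len x) with d | d
  · have hr := R.rot_three d
    have hy : y = R.rot x := by
      rcases h.eq_rot_of_fst_eq hxy with rfl | rfl | rfl | ⟨_, _⟩ | ⟨_, _⟩
      · omega
      · rfl
      · rw [hr] at h6; omega
      · omega
      · omega
    subst hy
    have d' : G.degree (R.rot x).fst = 3 := by rw [R.fst_rot, d]
    have h1 := hsp.len_le_six_of_degree_three h d'
    have h2 := hsp.len_le_of_squares hR d'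
    rw [hr] at h1 h2
    rcases hsp.demand_cases h with hc | hc | hc | hc | hc | hc | hc | hc <;> omega
  · have hr := R.rot_four d
    have hl := h.len_of_large_of_degree_four (by omega) d
    have hy : y = R.rot x ∨ y = R.rot (R.rot x) := by
      rcases h.eq_rot_of_fst_eq hxy with rfl | rfl | rfl | ⟨_, rfl⟩ | ⟨_, _⟩
      · omega
      · exact .inl rfl
      · exact .inr rfl
      · rw [hr] at h6; omega
      · omega
    have := len_le_of_triangles hR (y := R.rot x) (by rw [R.fst_rot, d]) hl.1 hl.2.1 hl.2.2
      (by rcases hy with rfl | rfl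
          · exact .inl hpos
          · exact .inr hpos)
    rw [hr] at this
    omega

variable (R) in
/-- A situation in which a vertex may be unable to meet the demands from the large faces on its own:
its face vector is `{3, 3, 5, 6}`, the dart `q` separates its pentagon from its hexagon, and the
edge between the hexagon and a triangle is a spoke. The missing unit is then paid by the end
point of `q`. -/
def IsDeficient (q : G.Dart) : Prop :=
  G.degree q.fst = 4 ∧ R.len (R.rot (R.rot q)) = 3 ∧ R.len (R.rot (R.rot (R.rot q))) = 3 ∧
    ((R.len q = 6 ∧ R.len (R.rot q) = 5 ∧ R.IsSpoke (R.rot (R.rot (R.rot q)))) ∨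
      (R.len q = 5 ∧ R.len (R.rot q) = 6 ∧ R.IsSpoke (R.rot q)))

/-- In the hexagon on one side of an edge between two deficient vertices, the edge opposite to it
would join two vertices of large faces. -/
theorem false_of_hexagon (hR : R.IsPlanarPCC) {q : G.Dart} (d : G.degree q.fst = 4)
    (h6 : R.len q = 6) (hq3 : R.len (R.rot (R.rot (R.rot q))) = 3)
    (hq : R.IsSpoke (R.rot (R.rot (R.rot q))))
    (hr3 : R.len (R.rot (R.rot q.symm)) = 3) (hr : R.IsSpoke (R.rot q.symm)) : False := by
  have h := hR.positivelyCurved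
  have hq4 := R.rot_four d
  obtain ⟨x, hx, dx, e⟩ : ∃ x : G.Dart, 42 ≤ R.len x ∧ G.degree x.fst = 3 ∧
      (R.rot (R.rot (R.rot q))).symm = R.rot x := by
    rcases hq.cases h with h' | ⟨x, hx, d, e⟩ | ⟨x, hx, d, e⟩
    · exact h'
    · have := (len_of_spoke_four h hx d (.inl e)).2
      rw [hq4] at this; omega
    · have := (len_of_spoke_four h hx d (.inr e)).2
      rw [hq4] at this; omega
  have hlx : R.len (R.rot x) = 6 := by rw [← (len_of_symm_eq_rot e).2, hq4, h6]
  have hr6 : R.len (R.rot q.symm) = 6 := by rw [len_rot_symm, h6]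
  obtain ⟨x₂, hx₂, dx₂, e₂⟩ : ∃ x : G.Dart, 42 ≤ R.len x ∧ G.degree x.fst = 3 ∧
      (R.rot q.symm).symm = R.rot x := by
    rcases hr.cases h with h' | ⟨x, hx, d, e⟩ | ⟨x, hx, d, e⟩
    · exact h'
    · have := (len_of_spoke_four h hx d (.inl e)).1
      omega
    · have := (len_of_spoke_four h hx d (.inr e)).1
      omega
  -- the boundary walk of the hexagon
  have hwalk := R.facePerm_of_len_six (d := x.symm) (by rw [← len_rot, hlx])
  simp only [facePerm_apply, SimpleGraph.Dart.symm_symm, ← e, hq4, e₂] at hwalk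
  have hx₃ : 42 ≤ R.len (R.rot (R.rot x₂)).symm := by
    rw [← len_rot, R.rot_three dx₂]; exact hx₂
  set xn := R.rot x.symm with hxn
  have hxn' : 42 ≤ R.len xn := by rwa [hxn, len_rot_symm]
  have hlxs : R.len x.symm = 6 := by rw [← len_rot, hlx]
  have dxn : G.degree xn.fst = 3 := by
    rcases h.degree_of_large (by omega : 41 ≤ R.len xn) with d | d
    · exact d
    · have e := h.len_of_large_of_degree_four (by omega : 41 ≤ R.len xn) d
      have e' : R.rot (R.rot (R.rot xn)) = x.symm := R.rot.injective (R.rot_four d)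
      rw [e'] at e
      omega
  have e' : R.rot (R.rot xn) = x.symm := R.rot.injective (R.rot_three dxn)
  have ht : (R.rot (R.rot (R.rot x₂)).symm).symm = R.rot xn := R.rot.injective (hwalk.trans e'.symm)
  have hlen := len_of_symm_eq_rot ht
  rw [e', hlxs] at hlen
  have hcl := len_of_spoke_three h hxn' dxn ht
  have hdem := demand_of_degree_three hxn' dxn ht
  rw [if_pos (by omega)] at hdem
  have := demand_nonpos_of_large hR hx₃ (y := R.rot (R.rot (R.rot x₂)).symm) (R.fst_rot _)
  rw [hdem] at this
  norm_num at this

theorem IsDeficient.not_symm (hR : R.IsPlanarPCC) {q : G.Dart} (hq : R.IsDeficient q) :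
    ¬ R.IsDeficient q.symm := by
  rintro ⟨d', h2', h3', hc'⟩
  obtain ⟨d, h2, h3, hc⟩ := hq
  rw [len_rot_symm, ← len_rot] at hc'
  rcases hc with ⟨h6, h5, hs⟩ | ⟨h5, h6, hs⟩
  · rcases hc' with ⟨_, _, _⟩ | ⟨_, _, hs'⟩
    · omega
    · exact false_of_hexagon hR d h6 h3 hs h2' hs'
  · rcases hc' with ⟨_, _, hs'⟩ | ⟨_, _, _⟩
    · refine false_of_hexagon hR (q := q.symm) d' (by rw [← len_rot, h6]) h3' hs' ?_ ?_
      · rw [SimpleGraph.Dart.symm_symm, h2]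
      · rwa [SimpleGraph.Dart.symm_symm]
    · omega

end RotationSystem

/-! ### Vertices of degree three, and squares or hexagons in degree four -/

namespace RotationSystem

variable {V : Type*} {G : SimpleGraph V} {R : RotationSystem G}
variable [Fintype V] [DecidableEq V] [DecidableRel G.Adj]

open Classical in
variable (R) in
/-- The unit of charge which a deficient vertex gets through the dart `q`. -/
noncomputable def relief (q : G.Dart) : ℚ := if R.IsDeficient q then 1 else 0

variable (R) in
/-- The charge which the initial vertex of `y` gives away along `y`. -/
noncomputable def cost (y : G.Dart) : ℚ := R.demand y + R.relief y.symm - R.relief y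

/-- An upper bound for `cost` in terms of the sizes of the two faces along the edge. -/
def costBound (p q : ℕ) : ℚ :=
  if (p = 3 ∧ q = 6) ∨ (p = 6 ∧ q = 3) ∨ (p = 4 ∧ q = 4) then 6
  else if p = 3 ∧ q = 3 then 3
  else if (p = 5 ∧ q = 6) ∨ (p = 6 ∧ q = 5) then 1
  else 0

theorem relief_nonneg (q : G.Dart) : 0 ≤ R.relief q := by
  unfold relief; split_ifs <;> norm_num

theorem relief_le_one (q : G.Dart) : R.relief q ≤ 1 := by
  unfold relief; split_ifs <;> norm_num

theorem relief_symm_eq_zero {y : G.Dart}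
    (hy : ¬ ((R.len y = 5 ∧ R.len (R.rot y) = 6) ∨ (R.len y = 6 ∧ R.len (R.rot y) = 5))) :
    R.relief y.symm = 0 := by
  apply if_neg
  rintro ⟨-, -, -, h⟩
  rw [len_rot_symm, ← len_rot] at h
  omega

theorem demand_le (h : R.PositivelyCurved) (y : G.Dart) (hpos : 0 < R.demand y) :
    (((R.len y = 3 ∧ R.len (R.rot y) = 6) ∨ (R.len y = 6 ∧ R.len (R.rot y) = 3) ∨
      (R.len y = 4 ∧ R.len (R.rot y) = 4)) ∧ R.demand y ≤ 6) ∨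
    (R.len y = 3 ∧ R.len (R.rot y) = 3 ∧ R.demand y ≤ 3) := by
  rcases (isSpoke_of_demand_pos hpos).demand_cases h with
    ⟨a, b, c⟩ | ⟨a, b, c⟩ | ⟨a, b, c⟩ | ⟨a, b, c⟩ | ⟨a, b, c⟩ | ⟨a, b, c⟩ | ⟨a, b, c⟩ | ⟨a, b, c⟩
  · exact .inr ⟨a, b, c⟩
  · linarith
  · linarith
  · linarith
  · linarith
  · exact .inl ⟨.inl ⟨a, b⟩, c.le⟩
  · exact .inl ⟨.inr (.inl ⟨a, b⟩), c.le⟩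
  · exact .inl ⟨.inr (.inr ⟨a, b⟩), c.le⟩

theorem cost_le_of_demand_nonpos {y : G.Dart} (hy : R.demand y ≤ 0) :
    R.cost y ≤ if (R.len y = 5 ∧ R.len (R.rot y) = 6) ∨ (R.len y = 6 ∧ R.len (R.rot y) = 5)
      then 1 else 0 := by
  have h1 := R.relief_nonneg y
  have h2 := R.relief_le_one y.symm
  unfold cost
  split_ifs with hc
  · linarith
  · rw [relief_symm_eq_zero hc]; linarith

theorem cost_le (h : R.PositivelyCurved) (y : G.Dart) :
    R.cost y ≤ costBound (R.len y) (R.len (R.rot y)) := by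
  by_cases hpos : 0 < R.demand y
  · have h1 := R.relief_nonneg y
    rcases demand_le h y hpos with ⟨hl, hd⟩ | ⟨ha, hb, hd⟩
    · rw [costBound, if_pos hl, cost, relief_symm_eq_zero (by omega)]
      linarith
    · rw [costBound, if_neg (by omega), if_pos ⟨ha, hb⟩, cost, relief_symm_eq_zero (by omega)]
      linarith
  · refine (cost_le_of_demand_nonpos (not_lt.1 hpos)).trans ?_
    unfold costBound
    split_ifs <;> norm_num

theorem cost_le_six (h : R.PositivelyCurved) (y : G.Dart) : R.cost y ≤ 6 := by
  refine (cost_le h y).trans ?_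
  unfold costBound
  split_ifs <;> norm_num

/-- A spoke separating a triangle from a square or a pentagon carries a gift. -/
theorem IsSpoke.cost_le (h : R.PositivelyCurved) {y : G.Dart} (hy : R.IsSpoke y)
    (hl : (R.len y = 3 ∧ (R.len (R.rot y) = 4 ∨ R.len (R.rot y) = 5)) ∨
      (R.len (R.rot y) = 3 ∧ (R.len y = 4 ∨ R.len y = 5))) : R.cost y ≤ -2 := by
  have h1 := R.relief_nonneg y
  rw [cost, relief_symm_eq_zero (by omega)]
  rcases hy.demand_cases h with
    ⟨a, b, c⟩ | ⟨a, b, c⟩ | ⟨a, b, c⟩ | ⟨a, b, c⟩ | ⟨a, b, c⟩ | ⟨a, b, c⟩ | ⟨a, b, c⟩ | ⟨a, b, c⟩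
  all_goals first
    | omega
    | linarith

theorem IsDeficient.cost_le (hR : R.IsPlanarPCC) {y : G.Dart} (hy : R.IsDeficient y) :
    R.cost y ≤ -1 := by
  have hd : R.demand y ≤ 0 := by
    by_contra! hpos
    have := demand_le hR.positivelyCurved y hpos
    obtain ⟨-, -, -, hc⟩ := hy
    omega
  have e1 : R.relief y = 1 := if_pos hy
  have e2 : R.relief y.symm = 0 := if_neg (hy.not_symm hR)
  rw [cost, e1, e2]
  linarith

theorem one_div_le_of_three_le {n k : ℕ} (hn : 3 ≤ n) (hk : n ≤ k) : 1 / (k : ℚ) ≤ 1 / (n : ℚ) :=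
  one_div_le_of_le (by omega) hk

theorem cost_sum_three (hR : R.IsPlanarPCC) (y : G.Dart) (d : G.degree y.fst = 3) :
    ∑ e : G.Dart with e.fst = y.fst, R.cost e ≤ 240 * R.curvature y.fst := by
  have h := hR.positivelyCurved
  have hK := hR.curvature_pos y.fst
  by_cases hex : ∃ e : G.Dart, e.fst = y.fst ∧ 0 < R.demand e
  · obtain ⟨e, he, hpos⟩ := hex
    rw [← he] at d ⊢
    have hsp := isSpoke_of_demand_pos hpos
    rw [R.curvature_three d, R.sum_darts_at_three d]
    have c0 := cost_le_six h e
    have c1 := cost_le_six h (R.rot e)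
    have c2 := cost_le_six h (R.rot (R.rot e))
    have hc3 := h.three_le_len (R.rot (R.rot e))
    rcases demand_le h e hpos with ⟨⟨a, b⟩ | ⟨a, b⟩ | ⟨a, b⟩, -⟩ | ⟨a, b, -⟩
    · have := one_div_le_of_three_le hc3 (hsp.len_le_six_of_degree_three h d (by omega))
      rw [a, b]
      norm_num at this ⊢
      linarith
    · have := one_div_le_of_three_le hc3 (hsp.len_le_six_of_degree_three h d (by omega))
      rw [a, b]
      norm_num at this ⊢
      linarith
    · have := one_div_le_of_three_le hc3 (hsp.len_le_of_squares hR d a b)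
      by_cases h4 : R.len (R.rot (R.rot e)) = 4
      · rw [a, b, h4]
        norm_num
        linarith
      · have c1 := cost_le h (R.rot e)
        have c2 := cost_le h (R.rot (R.rot e))
        rw [R.rot_three d, a, costBound, if_neg (by omega), if_neg (by omega),
          if_neg (by omega)] at c2
        rw [b, costBound, if_neg (by omega), if_neg (by omega), if_neg (by omega)] at c1
        rw [a, b]
        norm_num at this ⊢
        linarith
    · have : (0 : ℚ) ≤ (R.len (R.rot (R.rot e)) : ℚ)⁻¹ := by positivity
      rw [a, b]
      norm_num
      linarith
  · push Not at hex
    by_cases hex2 : ∃ e : G.Dart, e.fst = y.fst ∧ 0 < R.cost e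
    · obtain ⟨e, he, hpos⟩ := hex2
      rw [← he] at d hex hK ⊢
      have c0 := cost_le_of_demand_nonpos (hex e rfl)
      have c1 := cost_le_of_demand_nonpos (hex (R.rot e) (R.fst_rot e))
      have c2 := cost_le_of_demand_nonpos (hex (R.rot (R.rot e)) (by simp only [R.fst_rot]))
      rw [R.rot_three d] at c2
      rw [R.curvature_three d] at hK
      rw [R.curvature_three d, R.sum_darts_at_three d]
      have hl : (R.len e = 5 ∧ R.len (R.rot e) = 6) ∨ (R.len e = 6 ∧ R.len (R.rot e) = 5) := by
        by_contra hn
        rw [if_neg hn] at c0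
        linarith
      rw [if_pos hl] at c0
      have hsum : 1 / (R.len e : ℚ) + 1 / (R.len (R.rot e) : ℚ) = 11 / 30 := by
        rcases hl with ⟨a, b⟩ | ⟨a, b⟩ <;> rw [a, b] <;> norm_num
      have hc3 := h.three_le_len (R.rot (R.rot e))
      have hc7 : R.len (R.rot (R.rot e)) ≤ 7 := by
        by_contra hlt
        have := one_div_le_of_three_le (n := 8) (by norm_num) (not_le.1 hlt)
        norm_num at this hK hsum
        linarith
      by_cases h7 : R.len (R.rot (R.rot e)) = 7
      · rw [if_neg (by omega)] at c1 c2
        rw [h7]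
        norm_num at hsum ⊢
        linarith
      · have := one_div_le_of_three_le hc3 (k := 6) (by omega)
        have c1' : R.cost (R.rot e) ≤ 1 := c1.trans (by split_ifs <;> norm_num)
        have c2' : R.cost (R.rot (R.rot e)) ≤ 1 := c2.trans (by split_ifs <;> norm_num)
        norm_num at this hsum ⊢
        linarith
    · push Not at hex2
      have : ∑ e : G.Dart with e.fst = y.fst, R.cost e ≤ 0 :=
        Finset.sum_nonpos fun e he => hex2 e (by simpa using he)
      linarith

theorem pair_of_half_lt {a b : ℕ} (ha : 3 ≤ a) (hb : 3 ≤ b)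
    (hab : 1 / 2 < 1 / (a : ℚ) + 1 / (b : ℚ)) :
    (a = 3 ∧ b = 3) ∨ (a = 3 ∧ b = 4) ∨ (a = 4 ∧ b = 3) ∨ (a = 3 ∧ b = 5) ∨ (a = 5 ∧ b = 3) := by
  rcases pair_of_sum_inv ha hb (by linarith) with
    ⟨rfl, rfl⟩ | ⟨rfl, rfl⟩ | ⟨rfl, rfl⟩ | ⟨rfl, rfl⟩ | ⟨rfl, rfl⟩ | ⟨rfl, rfl⟩ | ⟨rfl, rfl⟩ |
      ⟨rfl, rfl⟩
  all_goals first
    | omega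
    | (norm_num at hab)

/-- The case of a spoke between two squares at a vertex of degree four. -/
theorem cost_sum_four_of_squares (hR : R.IsPlanarPCC) {e : G.Dart} (d : G.degree e.fst = 4)
    (a : R.len e = 4) (b : R.len (R.rot e) = 4) :
    ∑ e' : G.Dart with e'.fst = e.fst, R.cost e' ≤ 240 * R.curvature e.fst := by
  have h := hR.positivelyCurved
  have hc := h.corners_four d
  rw [R.curvature_four d, R.sum_darts_at_four d]
  have c0 := cost_le h e
  have c1 := cost_le h (R.rot e)
  have c2 := cost_le h (R.rot (R.rot e))
  have c3 := cost_le h (R.rot (R.rot (R.rot e)))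
  rw [R.rot_four d] at c3
  rw [a, b] at hc ⊢
  rw [a, b] at c0
  rw [b] at c1
  rw [a] at c3
  rcases pair_of_half_lt (h.three_le_len (R.rot (R.rot e)))
    (h.three_le_len (R.rot (R.rot (R.rot e)))) (by norm_num at hc ⊢; linarith) with
    ⟨p, q⟩ | ⟨p, q⟩ | ⟨p, q⟩ | ⟨p, q⟩ | ⟨p, q⟩
  all_goals
    rw [p] at c1
    rw [p, q] at c2 ⊢
    rw [q] at c3
    norm_num [costBound] at c0 c1 c2 c3 ⊢
    linarith

/-- The case of a spoke between a triangle and a hexagon at a vertex of degree four. -/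
theorem cost_sum_four_of_triangle_hexagon (hR : R.IsPlanarPCC) {e : G.Dart}
    (d : G.degree e.fst = 4) (hsp : R.IsSpoke e) (a : R.len e = 3) (b : R.len (R.rot e) = 6) :
    ∑ e' : G.Dart with e'.fst = e.fst, R.cost e' ≤ 240 * R.curvature e.fst := by
  have h := hR.positivelyCurved
  have hc := h.corners_four d
  rw [R.curvature_four d, R.sum_darts_at_four d]
  have hr := R.rot_four d
  have c0 := cost_le h e
  have c1 := cost_le h (R.rot e)
  have c2 := cost_le h (R.rot (R.rot e))
  have c3 := cost_le h (R.rot (R.rot (R.rot e)))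
  have hs3 : R.IsSpoke (R.rot (R.rot (R.rot e))) := by
    have := (hsp.adjacent h).1 a (by omega)
    rwa [(R.rot.symm_apply_eq).2 hr.symm] at this
  rw [hr] at c3
  rw [a, b] at hc ⊢
  rw [a, b] at c0
  rw [b] at c1
  rw [a] at c3
  rcases pair_of_half_lt (h.three_le_len (R.rot (R.rot e)))
    (h.three_le_len (R.rot (R.rot (R.rot e)))) (by norm_num at hc ⊢; linarith) with
    ⟨p, q⟩ | ⟨p, q⟩ | ⟨p, q⟩ | ⟨p, q⟩ | ⟨p, q⟩
  · rw [p] at c1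
    rw [p, q] at c2 ⊢
    rw [q] at c3
    norm_num [costBound] at c0 c1 c2 c3 ⊢
    linarith
  · rw [p] at c1
    rw [p, q] at c2 ⊢
    rw [q] at c3
    norm_num [costBound] at c0 c1 c2 c3 ⊢
    linarith
  · rw [p] at c1
    rw [p, q] at c2 ⊢
    rw [q] at c3
    norm_num [costBound] at c0 c1 c2 c3 ⊢
    linarith
  · -- the pentagon is adjacent to both triangles, and each spoke next to it carries a gift
    have g3 := hs3.cost_le h (by rw [hr]; omega)
    rw [p] at c1
    rw [p, q] at c2 ⊢
    have key : R.cost (R.rot e) + R.cost (R.rot (R.rot e)) ≤ 4 := by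
      by_cases hpos : 0 < R.demand (R.rot e)
      · have hs2 := ((isSpoke_of_demand_pos hpos).adjacent h).2.1 p (by omega)
        have g2 := hs2.cost_le h (by omega)
        norm_num [costBound] at c1
        linarith
      · have g1 := cost_le_of_demand_nonpos (not_lt.1 hpos)
        rw [if_neg (by omega)] at g1
        norm_num [costBound] at c2
        linarith
    norm_num [costBound] at c0 ⊢
    linarith
  · have hdef : R.IsDeficient (R.rot e) := by
      refine ⟨by rw [R.fst_rot, d], q, by rw [hr, a], .inl ⟨b, p, by rwa [hr]⟩⟩
    have g1 := hdef.cost_le hR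
    rw [p, q] at c2 ⊢
    rw [q] at c3
    norm_num [costBound] at c0 c2 c3 ⊢
    linarith

theorem cost_sum_four_of_hexagon_triangle (hR : R.IsPlanarPCC) {e : G.Dart}
    (d : G.degree e.fst = 4) (hsp : R.IsSpoke e) (a : R.len e = 6) (b : R.len (R.rot e) = 3) :
    ∑ e' : G.Dart with e'.fst = e.fst, R.cost e' ≤ 240 * R.curvature e.fst := by
  have h := hR.positivelyCurved
  have hc := h.corners_four d
  rw [R.curvature_four d, R.sum_darts_at_four d]
  have hr := R.rot_four d
  have c0 := cost_le h e
  have c1 := cost_le h (R.rot e)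
  have c2 := cost_le h (R.rot (R.rot e))
  have c3 := cost_le h (R.rot (R.rot (R.rot e)))
  have hs1 : R.IsSpoke (R.rot e) := (hsp.adjacent h).2.1 b (by omega)
  rw [hr] at c3
  rw [a, b] at hc ⊢
  rw [a, b] at c0
  rw [b] at c1
  rw [a] at c3
  rcases pair_of_half_lt (h.three_le_len (R.rot (R.rot e)))
    (h.three_le_len (R.rot (R.rot (R.rot e)))) (by norm_num at hc ⊢; linarith) with
    ⟨p, q⟩ | ⟨p, q⟩ | ⟨p, q⟩ | ⟨p, q⟩ | ⟨p, q⟩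
  · rw [p] at c1
    rw [p, q] at c2 ⊢
    rw [q] at c3
    norm_num [costBound] at c0 c1 c2 c3 ⊢
    linarith
  · rw [p] at c1
    rw [p, q] at c2 ⊢
    rw [q] at c3
    norm_num [costBound] at c0 c1 c2 c3 ⊢
    linarith
  · rw [p] at c1
    rw [p, q] at c2 ⊢
    rw [q] at c3
    norm_num [costBound] at c0 c1 c2 c3 ⊢
    linarith
  · have hdef : R.IsDeficient (R.rot (R.rot (R.rot e))) := by
      refine ⟨by rw [R.fst_rot, R.fst_rot, R.fst_rot, d], by rw [hr, b], by rw [hr, p],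
        .inr ⟨q, by rw [hr, a], by rwa [hr]⟩⟩
    have g3 := hdef.cost_le hR
    rw [p] at c1
    rw [p, q] at c2 ⊢
    norm_num [costBound] at c0 c1 c2 ⊢
    linarith
  · have g1 := hs1.cost_le h (by omega)
    rw [q] at c3
    rw [p, q] at c2 ⊢
    have key : R.cost (R.rot (R.rot (R.rot e))) + R.cost (R.rot (R.rot e)) ≤ 4 := by
      by_cases hpos : 0 < R.demand (R.rot (R.rot (R.rot e)))
      · have hs2 := ((isSpoke_of_demand_pos hpos).adjacent h).1 q (by rw [hr]; omega)
        rw [Equiv.symm_apply_apply] at hs2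
        have g2 := hs2.cost_le h (by omega)
        norm_num [costBound] at c3
        linarith
      · have g3 := cost_le_of_demand_nonpos (not_lt.1 hpos)
        rw [if_neg (by rw [hr]; omega)] at g3
        norm_num [costBound] at c2
        linarith
    norm_num [costBound] at c0 ⊢
    linarith

end RotationSystem

/-! ### Triangles in degree four, and degree five -/

namespace RotationSystem

variable {V : Type*} {G : SimpleGraph V} {R : RotationSystem G}
variable [Fintype V] [DecidableEq V] [DecidableRel G.Adj]

variable (R) in
/-- The only positive demands at `v` come along edges between two triangles, so that none of them
exceeds `3`. -/
def NoLargeDemand (v : V) : Prop :=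
  ∀ e : G.Dart, e.fst = v → 0 < R.demand e → R.len e = 3 ∧ R.len (R.rot e) = 3

theorem NoLargeDemand.cost_le (h : R.PositivelyCurved) {e : G.Dart}
    (hn : R.NoLargeDemand e.fst) :
    R.cost e ≤ if R.len e = 3 ∧ R.len (R.rot e) = 3 then 3
      else if (R.len e = 5 ∧ R.len (R.rot e) = 6) ∨ (R.len e = 6 ∧ R.len (R.rot e) = 5) then 1
      else 0 := by
  by_cases hpos : 0 < R.demand e
  · have hl := hn e rfl hpos
    have := RotationSystem.cost_le h e
    rw [costBound, if_neg (by omega), if_pos hl] at this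
    rwa [if_pos hl]
  · refine (cost_le_of_demand_nonpos (not_lt.1 hpos)).trans ?_
    split_ifs <;> norm_num

theorem cost_sum_four_of_three_triangles (hR : R.IsPlanarPCC) {e : G.Dart}
    (d : G.degree e.fst = 4) (hn : R.NoLargeDemand e.fst) (a : R.len e = 3)
    (b : R.len (R.rot e) = 3) (c : R.len (R.rot (R.rot e)) = 3)
    (hpos : 0 < R.demand e ∨ 0 < R.demand (R.rot e)) :
    ∑ e' : G.Dart with e'.fst = e.fst, R.cost e' ≤ 240 * R.curvature e.fst := by
  have h := hR.positivelyCurved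
  rw [R.curvature_four d, R.sum_darts_at_four d]
  have c0 := RotationSystem.cost_le h e
  have c1 := RotationSystem.cost_le h (R.rot e)
  have c2 := NoLargeDemand.cost_le h (e := R.rot (R.rot e)) (by simpa only [R.fst_rot] using hn)
  have c3 := NoLargeDemand.cost_le h (e := R.rot (R.rot (R.rot e)))
    (by simpa only [R.fst_rot] using hn)
  rw [R.rot_four d, a] at c3
  rw [c] at c2
  rw [a, b] at c0
  rw [b, c] at c1
  norm_num [costBound] at c0 c1 c2 c3
  have hl := h.three_le_len (R.rot (R.rot (R.rot e)))
  rw [a, b, c]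
  by_cases h3 : R.len (R.rot (R.rot (R.rot e))) = 3
  · rw [if_pos h3] at c2 c3
    rw [h3]
    norm_num
    linarith
  · rw [if_neg h3] at c2 c3
    have := one_div_le_of_three_le hl (len_le_of_triangles hR d a b c hpos)
    norm_num at this ⊢
    linarith

theorem pair_of_third_lt {a b : ℕ} (ha : 4 ≤ a) (hb : 4 ≤ b)
    (hab : 1 / 3 < 1 / (a : ℚ) + 1 / (b : ℚ)) : 1 / 3 + 1 / 240 ≤ 1 / (a : ℚ) + 1 / (b : ℚ) := by
  have ha' : a ≤ 11 := by
    by_contra hlt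
    have h1 := one_div_le_of_le (n := a) (k := 12) (by norm_num) (by omega)
    have h2 := one_div_le_of_le (by norm_num) hb
    norm_num at h1 h2 hab
    linarith
  have hb' : b ≤ 11 := by
    by_contra hlt
    have h1 := one_div_le_of_le (n := b) (k := 12) (by norm_num) (by omega)
    have h2 := one_div_le_of_le (by norm_num) ha
    norm_num at h1 h2 hab
    linarith
  interval_cases a <;> interval_cases b <;> first | (norm_num; done) | (norm_num at hab)

/-- The case of a spoke between two triangles at a vertex of degree four. -/
theorem cost_sum_four_of_triangles (hR : R.IsPlanarPCC) {e : G.Dart}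
    (d : G.degree e.fst = 4) (hn : R.NoLargeDemand e.fst) (hpos : 0 < R.demand e) :
    ∑ e' : G.Dart with e'.fst = e.fst, R.cost e' ≤ 240 * R.curvature e.fst := by
  have h := hR.positivelyCurved
  obtain ⟨a, b⟩ := hn e rfl hpos
  have hr := R.rot_four d
  by_cases hc : R.len (R.rot (R.rot e)) = 3
  · exact cost_sum_four_of_three_triangles hR d hn a b hc (.inl hpos)
  by_cases hd : R.len (R.rot (R.rot (R.rot e))) = 3
  · have hf : (R.rot (R.rot (R.rot e))).fst = e.fst := by simp only [R.fst_rot]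
    have := cost_sum_four_of_three_triangles hR (e := R.rot (R.rot (R.rot e)))
      (by rw [hf, d]) (by rwa [hf]) hd (by rw [hr, a]) (by rw [hr, b]) (.inr (by rwa [hr]))
    rwa [hf] at this
  have hl2 := h.three_le_len (R.rot (R.rot e))
  have hl3 := h.three_le_len (R.rot (R.rot (R.rot e)))
  have hcor := h.corners_four d
  rw [R.curvature_four d, R.sum_darts_at_four d]
  have c0 := RotationSystem.cost_le h e
  have c1 := NoLargeDemand.cost_le h (e := R.rot e) (by simpa only [R.fst_rot] using hn)
  have c2 := NoLargeDemand.cost_le h (e := R.rot (R.rot e)) (by simpa only [R.fst_rot] using hn)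
  have c3 := NoLargeDemand.cost_le h (e := R.rot (R.rot (R.rot e)))
    (by simpa only [R.fst_rot] using hn)
  rw [hr, if_neg (by omega), if_neg (by omega)] at c3
  rw [if_neg (by omega), if_neg (by omega)] at c1
  rw [if_neg (by omega)] at c2
  rw [a, b] at c0 hcor ⊢
  norm_num [costBound] at c0
  -- the second edge of the triangle lying on a large face is a spoke with a gift
  have gift : ∀ e' : G.Dart, e'.fst = e.fst → R.IsSpoke e' →
      ((R.len e' = 3 ∧ R.len (R.rot e') ≠ 3) ∨ (R.len (R.rot e') = 3 ∧ R.len e' ≠ 3)) →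
      R.cost e' ≤ -2 := by
    intro e' he' hs hl
    refine hs.cost_le h ?_
    have hno := hn e' he'
    rcases hs.demand_cases h with hx | hx | hx | hx | hx | hx | hx | hx <;> try omega
    all_goals
      have := hno (by rw [hx.2.2]; norm_num)
      omega
  have key : R.cost (R.rot e) + R.cost (R.rot (R.rot (R.rot e))) ≤ -2 := by
    rcases ((isSpoke_of_demand_pos hpos).adjacent h).2.2 a b with hs | hs
    · rw [(R.rot.symm_apply_eq).2 hr.symm] at hs
      have := gift _ (by simp only [R.fst_rot]) hs (.inr ⟨by rw [hr, a], hd⟩)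
      linarith
    · have := gift _ (R.fst_rot e) hs (.inl ⟨b, hc⟩)
      linarith
  have hK := pair_of_third_lt (a := R.len (R.rot (R.rot e)))
    (b := R.len (R.rot (R.rot (R.rot e)))) (by omega) (by omega) (by norm_num at hcor ⊢; linarith)
  by_cases h56 : (R.len (R.rot (R.rot e)) = 5 ∧ R.len (R.rot (R.rot (R.rot e))) = 6) ∨
      (R.len (R.rot (R.rot e)) = 6 ∧ R.len (R.rot (R.rot (R.rot e))) = 5)
  · rw [if_pos h56] at c2
    rcases h56 with ⟨p, q⟩ | ⟨p, q⟩ <;> rw [p, q] <;> norm_num <;> linarith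
  · rw [if_neg h56] at c2
    norm_num at hK ⊢
    linarith

theorem cost_sum_four (hR : R.IsPlanarPCC) (y : G.Dart) (d : G.degree y.fst = 4) :
    ∑ e : G.Dart with e.fst = y.fst, R.cost e ≤ 240 * R.curvature y.fst := by
  have h := hR.positivelyCurved
  have hK := hR.curvature_pos y.fst
  by_cases hn : R.NoLargeDemand y.fst
  · by_cases hex : ∃ e : G.Dart, e.fst = y.fst ∧ 0 < R.demand e
    · obtain ⟨e, he, hpos⟩ := hex
      rw [← he] at d hn ⊢
      exact cost_sum_four_of_triangles hR d hn hpos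
    push Not at hex
    by_cases hex2 : ∃ e : G.Dart, e.fst = y.fst ∧ 0 < R.cost e
    · obtain ⟨e, he, hpos⟩ := hex2
      rw [← he] at d hex hK ⊢
      have hc : ∀ e' : G.Dart, e'.fst = e.fst → R.cost e' ≤ 1 := fun e' he' =>
        (cost_le_of_demand_nonpos (hex e' he')).trans (by split_ifs <;> norm_num)
      have c0 := cost_le_of_demand_nonpos (hex e rfl)
      have c1 := hc (R.rot e) (R.fst_rot e)
      have c2 := hc (R.rot (R.rot e)) (by simp only [R.fst_rot])
      have c3 := hc (R.rot (R.rot (R.rot e))) (by simp only [R.fst_rot])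
      have hcor := h.corners_four d
      rw [R.curvature_four d, R.sum_darts_at_four d]
      have hl : (R.len e = 5 ∧ R.len (R.rot e) = 6) ∨ (R.len e = 6 ∧ R.len (R.rot e) = 5) := by
        by_contra hno
        rw [if_neg hno] at c0
        linarith
      rw [if_pos hl] at c0
      have hsum : 1 / (R.len e : ℚ) + 1 / (R.len (R.rot e) : ℚ) = 11 / 30 := by
        rcases hl with ⟨a, b⟩ | ⟨a, b⟩ <;> rw [a, b] <;> norm_num
      rcases pair_of_half_lt (h.three_le_len (R.rot (R.rot e)))
        (h.three_le_len (R.rot (R.rot (R.rot e)))) (by linarith) with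
        ⟨p, q⟩ | ⟨p, q⟩ | ⟨p, q⟩ | ⟨p, q⟩ | ⟨p, q⟩ <;> rw [p, q] at hcor ⊢ <;>
          norm_num at hcor hsum ⊢ <;> linarith
    · push Not at hex2
      have : ∑ e : G.Dart with e.fst = y.fst, R.cost e ≤ 0 :=
        Finset.sum_nonpos fun e he => hex2 e (by simpa using he)
      linarith
  · unfold NoLargeDemand at hn
    push Not at hn
    obtain ⟨e, he, hpos, hne⟩ := hn
    rw [← he] at d ⊢
    have hsp := isSpoke_of_demand_pos hpos
    rcases demand_le h e hpos with ⟨⟨a, b⟩ | ⟨a, b⟩ | ⟨a, b⟩, -⟩ | ⟨a, b, -⟩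
    · exact cost_sum_four_of_triangle_hexagon hR d hsp a b
    · exact cost_sum_four_of_hexagon_triangle hR d hsp a b
    · exact cost_sum_four_of_squares hR d a b
    · exact absurd b (hne a)

/-- Among three consecutive edges between triangles which carry positive demands, the first one
or the last one is next to another spoke. -/
theorem exists_adjacent_spoke (h : R.PositivelyCurved) {e : G.Dart}
    (h0 : 0 < R.demand e) (h1 : 0 < R.demand (R.rot e)) (h2 : 0 < R.demand (R.rot (R.rot e)))
    (l0 : R.len e = 3) (l1 : R.len (R.rot e) = 3) (l2 : R.len (R.rot (R.rot e)) = 3)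
    (l3 : R.len (R.rot (R.rot (R.rot e))) = 3) :
    R.IsSpoke (R.rot.symm e) ∨ R.IsSpoke (R.rot (R.rot (R.rot e))) := by
  rcases cases_of_demand_pos_of_triangles h h0 l0 l1 with ⟨x, hx, dx, ex⟩ | ⟨x, hx, dx, ex⟩
  · rcases cases_of_demand_pos_of_triangles h h2 l2 l3 with ⟨z, hz, dz, ez⟩ | ⟨z, hz, dz, ez⟩
    · exact .inr (h.isSpoke_rot hz ez (by rw [← (len_of_symm_eq_rot ez).2, l3]))
    · exfalso
      obtain ⟨w, hw, -, -, ew⟩ := PositivelyCurved.spoke_rot_symm hz (by rw [ez, R.rot_four dz])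
        (by rw [len_rot_symm, l2])
      rw [Equiv.symm_apply_apply] at ew
      have hx' : 42 ≤ R.len (R.rot x.symm) := by rwa [len_rot_symm]
      rcases h.spoke_rot hx ex (by rw [← (len_of_symm_eq_rot ex).2, l1]) with ⟨d3, e3⟩ | ⟨d4, e4⟩
      · rw [demand_of_degree_three hx' d3 e3, l1, l2] at h1
        norm_num at h1
      · have hf : w = R.rot x.symm := by
          apply h.large_unique hx' hw
          rw [← snd_eq_of_symm_eq_rot ew, snd_eq_of_symm_eq_rot_rot e4]
        rw [hf, e4] at ew
        have := R.rot.injective ew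
        exact R.rot_ne (h.three_le_degree _) this
  · exact .inl (isSpoke_rot_symm hx (by rw [ex, R.rot_four dx]) l0)

theorem cost_sum_five (hR : R.IsPlanarPCC) (y : G.Dart) (d : G.degree y.fst = 5) :
    ∑ e : G.Dart with e.fst = y.fst, R.cost e ≤ 240 * R.curvature y.fst := by
  have h := hR.positivelyCurved
  -- the list of corners starts after the largest of them
  obtain ⟨e, he, hother⟩ : ∃ e : G.Dart, e.fst = y.fst ∧
      (R.len e = 3 ∧ R.len (R.rot e) = 3 ∧ R.len (R.rot (R.rot e)) = 3 ∧
        R.len (R.rot (R.rot (R.rot e))) = 3) := by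
    have aux : ∀ e : G.Dart, e.fst = y.fst → R.len e ≠ 3 →
        R.len (R.rot e) = 3 ∧ R.len (R.rot (R.rot e)) = 3 ∧
        R.len (R.rot (R.rot (R.rot e))) = 3 ∧ R.len (R.rot (R.rot (R.rot (R.rot e)))) = 3 := by
      intro e he hne
      have hc := h.corners_five (d := e) (by rw [he, d])
      have h3 := fun e => one_div_le_third (h.three_le_len e)
      have h4 : ∀ e, R.len e ≠ 3 → 1 / (R.len e : ℚ) ≤ 1 / 4 := by
        intro e hne
        have h5 := one_div_le_of_le (k := 4) (by norm_num)
          (Nat.lt_of_le_of_ne (h.three_le_len e) (Ne.symm hne))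
        simpa only [Nat.cast_ofNat] using h5
      have := h4 e hne
      have a1 := h3 (R.rot e)
      have a2 := h3 (R.rot (R.rot e))
      have a3 := h3 (R.rot (R.rot (R.rot e)))
      have a4 := h3 (R.rot (R.rot (R.rot (R.rot e))))
      refine ⟨?_, ?_, ?_, ?_⟩ <;> by_contra hne' <;> have := h4 _ hne' <;> linarith
    by_cases hex : ∃ e : G.Dart, e.fst = y.fst ∧ R.len e ≠ 3
    · obtain ⟨e, he, hne⟩ := hex
      exact ⟨R.rot e, by rw [R.fst_rot, he], aux e he hne⟩
    · push Not at hex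
      exact ⟨y, rfl, hex _ rfl, hex _ (by simp only [R.fst_rot]), hex _ (by simp only [R.fst_rot]),
        hex _ (by simp only [R.fst_rot])⟩
  rw [← he] at d ⊢
  obtain ⟨l0, l1, l2, l3⟩ := hother
  have hr := R.rot_five d
  have hc := h.corners_five d
  rw [R.curvature_five d, R.sum_darts_at_five d]
  have c0 := cost_le h e
  have c1 := cost_le h (R.rot e)
  have c2 := cost_le h (R.rot (R.rot e))
  have c3 := cost_le h (R.rot (R.rot (R.rot e)))
  have c4 := cost_le h (R.rot (R.rot (R.rot (R.rot e))))
  rw [l0, l1] at c0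
  rw [l1, l2] at c1
  rw [l2, l3] at c2
  rw [l3] at c3
  rw [hr, l0] at c4
  rw [l0, l1, l2, l3] at hc ⊢
  have hl := h.three_le_len (R.rot (R.rot (R.rot (R.rot e))))
  have hl' : R.len (R.rot (R.rot (R.rot (R.rot e)))) ≤ 5 := by
    by_contra hlt
    have := one_div_le_of_three_le (n := 6) (by norm_num) (not_le.1 hlt)
    norm_num at this hc
    linarith
  obtain l4 | l4 | l4 : R.len (R.rot (R.rot (R.rot (R.rot e)))) = 3 ∨
      R.len (R.rot (R.rot (R.rot (R.rot e)))) = 4 ∨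
      R.len (R.rot (R.rot (R.rot (R.rot e)))) = 5 := by omega
  · rw [l4] at c3 c4 ⊢
    norm_num [costBound] at c0 c1 c2 c3 c4 ⊢
    linarith
  · rw [l4] at c3 c4 ⊢
    norm_num [costBound] at c0 c1 c2 c3 c4 ⊢
    linarith
  · have gift : ∀ e' : G.Dart, ¬ 0 < R.demand e' → R.len e' = 3 → R.cost e' ≤ 0 := by
      intro e' hno hl
      have := cost_le_of_demand_nonpos (not_lt.1 hno)
      rwa [if_neg (by omega)] at this
    rw [l4] at c3 c4 ⊢
    norm_num [costBound] at c0 c1 c2 c3 c4 ⊢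
    by_cases h0 : 0 < R.demand e
    · by_cases h1 : 0 < R.demand (R.rot e)
      · by_cases h2 : 0 < R.demand (R.rot (R.rot e))
        · rcases exists_adjacent_spoke h h0 h1 h2 l0 l1 l2 l3 with hs | hs
          · rw [(R.rot.symm_apply_eq).2 hr.symm] at hs
            have := hs.cost_le h (by rw [hr]; omega)
            linarith
          · have := hs.cost_le h (by omega)
            linarith
        · have := gift _ h2 l2
          linarith
      · have := gift _ h1 l1
        linarith
    · have := gift _ h0 l0
      linarith

/-- No vertex gives away more charge than it has. -/
theorem cost_sum_le (hR : R.IsPlanarPCC) (v : V) :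
    ∑ e : G.Dart with e.fst = v, R.cost e ≤ 240 * R.curvature v := by
  have h := hR.positivelyCurved
  obtain ⟨y, rfl⟩ := exists_dart_of_degree_pos (G := G) (v := v)
    (by have := h.three_le_degree v; omega)
  rcases h.degree_cases y.fst with d | d | d
  · exact cost_sum_three hR y d
  · exact cost_sum_four hR y d
  · exact cost_sum_five hR y d

theorem relief_symm_eq_zero_of_large (h : R.PositivelyCurved) {x y : G.Dart}
    (hx : 42 ≤ R.len x) (hxy : y.fst = x.fst) : R.relief y.symm = 0 := by
  apply relief_symm_eq_zero
  rcases h.degree_of_large (by omega : 41 ≤ R.len x) with d | d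
  · have hr := R.rot_three d
    have hcl := h.len_of_large_of_degree_three hx d
    rcases h.eq_rot_of_fst_eq hxy with rfl | rfl | rfl | ⟨_, _⟩ | ⟨_, _⟩
    · omega
    · omega
    · rw [hr]; omega
    · omega
    · omega
  · have hcl := h.len_of_large_of_degree_four (by omega) d
    rcases h.eq_rot_of_fst_eq hxy with rfl | rfl | rfl | ⟨_, rfl⟩ | ⟨_, _⟩ <;> omega

/-- An edge on the boundary of a large face is not a spoke. -/
theorem demand_symm_eq_zero (h : R.PositivelyCurved) {x y : G.Dart} (hx : 42 ≤ R.len x)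
    (hy : y = x ∨ R.rot y = x) : R.demand y.symm = 0 := by
  apply demand_of_not_isSpoke
  have hfst : y.fst = x.fst := by
    rcases hy with rfl | rfl
    · rfl
    · rw [R.fst_rot]
  have d3 := h.three_le_degree x.fst
  have n1 := R.rot_ne d3
  have n2 := R.rot_rot_ne d3
  rintro ⟨z, hz, hc⟩
  rw [SimpleGraph.Dart.symm_symm] at hc
  have hzx : z = x := by
    apply h.large_unique hx hz
    rw [← hfst]
    rcases hc with e | ⟨-, e⟩ <;> rw [e] <;> simp only [R.fst_rot]
  subst hzx
  rcases hy with rfl | hy <;> rcases hc with e | ⟨d, e⟩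
  · exact n1 e.symm
  · exact n2 e.symm
  · rw [e] at hy; exact n2 hy
  · rw [e] at hy
    have := R.rot_four d
    rw [hy] at this
    exact n1 this

end RotationSystem

/-! ### The total charge -/

namespace RotationSystem

variable {V : Type*} {G : SimpleGraph V} {R : RotationSystem G}
theorem sum_symm [Fintype G.Dart] (g : G.Dart → ℚ) : ∑ y : G.Dart, g y.symm = ∑ y : G.Dart, g y :=
  Equiv.sum_comp (SimpleGraph.Dart.symm_involutive.toPerm) g

variable [Fintype V] [DecidableEq V] [DecidableRel G.Adj]

/-- A vertex of a large face with `N` sides collects six units more than its share `240 / N`. -/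
theorem le_curvature_add_demand (h : R.PositivelyCurved) {x : G.Dart} (hx : 42 ≤ R.len x) :
    240 / (R.len x : ℚ) + 6 ≤
      240 * R.curvature x.fst + ∑ y : G.Dart with y.fst = x.fst, R.demand y.symm := by
  have hdiv : 240 / (R.len x : ℚ) = 240 * (1 / (R.len x : ℚ)) := by ring
  rcases h.degree_of_large (by omega : 41 ≤ R.len x) with d | d
  · have hr := R.rot_three d
    rw [R.curvature_three d, R.sum_darts_at_three d, demand_symm_eq_zero h hx (.inl rfl),
      demand_symm_eq_zero h hx (.inr hr)]
    have e : (R.rot x).symm.symm = R.rot x := SimpleGraph.Dart.symm_symm _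
    have hdem := demand_of_degree_three hx d e
    rw [(len_of_symm_eq_rot e).1, (len_of_symm_eq_rot e).2] at hdem
    rw [hdem, hdiv]
    rcases h.len_of_large_of_degree_three hx d with
      ⟨a, b⟩ | ⟨a, b⟩ | ⟨a, b⟩ | ⟨a, b⟩ | ⟨a, b⟩ | ⟨a, b⟩ | ⟨a, b⟩ | ⟨a, b⟩
    all_goals
      rw [a, b]
      norm_num
      linarith
  · have hr := R.rot_four d
    obtain ⟨a, b, c⟩ := h.len_of_large_of_degree_four (by omega) d
    rw [R.curvature_four d, R.sum_darts_at_four d, demand_symm_eq_zero h hx (.inl rfl),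
      demand_symm_eq_zero h hx (.inr hr),
      demand_of_degree_four hx d (.inl (SimpleGraph.Dart.symm_symm _)),
      demand_of_degree_four hx d (.inr (SimpleGraph.Dart.symm_symm _)), a, b, c, hdiv]
    norm_num
    linarith

/-- After the transfers of charge, each vertex of a large face with `N` sides has at least
`240 / N + 6` units, and no vertex has a negative charge. -/
theorem charge_le (hR : R.IsPlanarPCC) (v : V) :
    ∑ x : G.Dart with x.fst = v, (if 42 ≤ R.len x then 240 / (R.len x : ℚ) + 6 else 0) ≤
      240 * R.curvature v + ∑ y : G.Dart with y.fst = v, (R.demand y.symm - R.cost y) := by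
  have h := hR.positivelyCurved
  rw [Finset.sum_sub_distrib]
  by_cases hex : ∃ x : G.Dart, x.fst = v ∧ 42 ≤ R.len x
  · obtain ⟨x, rfl, hx⟩ := hex
    have hcost : ∑ y : G.Dart with y.fst = x.fst, R.cost y ≤ 0 := by
      refine Finset.sum_nonpos fun y hy => ?_
      have hy : y.fst = x.fst := by simpa using hy
      have h1 := demand_nonpos_of_large hR hx hy
      have h2 := R.relief_nonneg y
      rw [cost, relief_symm_eq_zero_of_large h hx hy]
      linarith
    have hsum : ∑ y : G.Dart with y.fst = x.fst,
        (if 42 ≤ R.len y then 240 / (R.len y : ℚ) + 6 else 0) = 240 / (R.len x : ℚ) + 6 := by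
      rw [Finset.sum_eq_single_of_mem x (by simp), if_pos hx]
      intro y hy hne
      refine if_neg fun hlarge => hne (h.large_unique hx hlarge (by simpa using hy))
    have := le_curvature_add_demand h hx
    rw [hsum]
    linarith
  · push Not at hex
    have h1 := cost_sum_le hR v
    rw [Finset.sum_eq_zero fun x hx => if_neg (not_le.2 (hex x (by simpa using hx))),
      Finset.sum_eq_zero (f := fun y : G.Dart => R.demand y.symm)]
    · linarith
    · intro y hy
      have hy : y.fst = v := by simpa using hy
      refine demand_of_not_isSpoke ?_
      rintro ⟨x, hx, hc⟩
      rw [SimpleGraph.Dart.symm_symm] at hc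
      have := hex x (by
        rw [← hy]
        rcases hc with e | ⟨-, e⟩ <;> rw [e] <;> simp only [R.fst_rot])
      omega

/-- The transfers of charge cancel out in total. -/
theorem sum_demand_symm_sub_cost : ∑ y : G.Dart, (R.demand y.symm - R.cost y) = 0 := by
  simp only [cost, Finset.sum_sub_distrib, Finset.sum_add_distrib, sum_symm R.demand,
    sum_symm R.relief]
  ring

end RotationSystem

theorem theorem13p1 {V : Type*} [Fintype V] [DecidableEq V] (G : SimpleGraph V)
    [DecidableRel G.Adj] (R : RotationSystem G) (hR : R.IsPlanarPCC) (f : R.Face) :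
    R.faceSize f ≤ 41 := by
  by_contra! hf
  have hN : 42 ≤ R.faceSize f := hf
  have htotal := Finset.sum_le_sum fun v (_ : v ∈ Finset.univ) =>
    RotationSystem.charge_le hR v
  rw [Finset.sum_add_distrib, Finset.sum_fiberwise Finset.univ (fun d : G.Dart => d.fst),
    Finset.sum_fiberwise Finset.univ (fun d : G.Dart => d.fst), ← Finset.mul_sum,
    R.sum_curvature hR.spherical, RotationSystem.sum_demand_symm_sub_cost] at htotal
  have hface : ∑ x : G.Dart with R.faceOf x = f, (240 / (R.faceSize f : ℚ) + 6) ≤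
      ∑ x : G.Dart, (if 42 ≤ R.len x then 240 / (R.len x : ℚ) + 6 else 0) := by
    rw [Finset.sum_filter]
    refine Finset.sum_le_sum fun x _ => ?_
    by_cases hx : R.faceOf x = f
    · have hlen : R.len x = R.faceSize f := by rw [RotationSystem.len, hx]
      rw [if_pos hx, hlen, if_pos hN]
    · rw [if_neg hx]
      split_ifs
      · positivity
      · exact le_rfl
  rw [Finset.sum_const, nsmul_eq_mul] at hface
  change (R.faceSize f : ℚ) * _ ≤ _ at hface
  have hN' : (42 : ℚ) ≤ R.faceSize f := by exact_mod_cast hN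
  have hmul : (R.faceSize f : ℚ) * (240 / (R.faceSize f : ℚ) + 6) =
      240 + 6 * R.faceSize f := by
    have : (R.faceSize f : ℚ) ≠ 0 := by linarith
    field_simp
  rw [hmul] at hface
  linarith
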